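/- Let $n\ge 1$, let $\tau=\frac1n\mathrm{tr}$ be the normalized trace on $M_n(\mathbb C)$, and let $\sigma\in M_n(\mathbb C)$ be positive definite with $\tau(\sigma)=1$. Let $(P_t)_{t\ge 0}$ be a quantum Markov semigroup on $M_n(\mathbb C)$, i.e. a strongly continuous semigroup of unital completely positive linear maps, which is GNS-symmetric with respect to $\sigma$: $\tau(P_t(A)B\sigma)=\tau(AP_t(B)\sigma)$ for all $A,B\in M_n(\mathbb C)$, $t\ge 0$. Let $\mathcal L$ be its generator, $P_t=e^{-t\mathcal L}$, let $P_t^\dagger$ be the adjoint given by $\tau(P_t(A)B)=\tau(AP_t^\dagger(B))$, and let $\Gamma(A,B)=\frac12(\mathcal L(A)^*B+A^*\mathcal L(B)-\mathcal L(A^*B))$. A finite-dimensional Hilbert $C^*$-bimodule over $M_n(\mathbb C)$ is a finite-dimensional bimodule $F$ with a sesquilinear map $(\cdot|\cdot)\colon F\times F\to M_n(\mathbb C)$ (conjugate linear in the first argument) such that $(\xi|A\eta B)=(A^*\xi|\eta)B$, $(\xi|\xi)\ge 0$, and $(\xi|\xi)=0$ only for $\xi=0$; it is normed by $\|\xi\|=\|(\xi|\xi)\|^{1/2}$.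 Let $(F,(V_t)_{t\in\mathbb R},\mathcal J,\partial)$ be a first-order differential calculus for $\mathcal L$, that is, $F$ is a finite-dimensional Hilbert $C^*$-bimodule over $M_n(\mathbb C)$, $(V_t)$ is a strongly continuous group of linear isometries of $F$, $\mathcal J\colon F\to F$ is anti-linear, $\partial\colon M_n(\mathbb C)\to F$ is linear with $\partial(AB)=A\,\partial(B)+\partial(A)\,B$, and for all $A,B\in M_n(\mathbb C)$, $\xi,\eta\in F$, $t\in\mathbb R$: (a) $V_t(A\xi B)=\sigma^{it}A\sigma^{-it}(V_t\xi)\sigma^{it}B\sigma^{-it}$; (b) $\mathcal J(A\xi B)=\sigma^{1/2}B^*\sigma^{-1/2}(\mathcal J\xi)\sigma^{1/2}A^*\sigma^{-1/2}$; (c) $\tau((\mathcal J\xi|\mathcal J\eta)\sigma)=\tau((\eta|\xi)\sigma)$; (d) $\mathcal JV_t=V_t\mathcal J$; (e) $\partial(\sigma^{it}A\sigma^{-it})=V_t\partial(A)$; (f) $\partial(\sigma^{1/2}A^*\sigma^{-1/2})=\mathcal J\partial(A)$; (g) $F=\mathrm{lin}\{\partial(A)B\mid A,B\in M_n(\mathbb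 C)\}$; (h) $\Gamma(A,B)=(\partial(A)|\partial(B))$. Let $z\mapsto V_z$ be the analytic extension of $t\mapsto V_t$ to $\mathbb C$, and for positive definite $\rho\in M_n(\mathbb C)$ put $V^\rho_z\xi=\rho^{iz}\sigma^{-iz}(V_z\xi)\sigma^{iz}\rho^{-iz}$. An operator mean function is a continuous function $\Lambda\colon[0,\infty)^2\to[0,\infty)$ such that $\Lambda(s,t)=s\,h(t/s)$ for all $s,t>0$, for some operator monotone function $h\colon(0,\infty)\to(0,\infty)$ with $h(1)=1$. With $f(t)=\Lambda(1,t)$ put $\|\xi\|_{\Lambda,\rho}^2=\tau[(\xi|f(V^\rho_{-i})\xi)\rho]$, where $f(V^\rho_{-i})$ is the functional calculus of $V^\rho_{-i}$, which is positive with respect to the inner product $\tau((\cdot|\cdot)\rho)$ on $F$. Let $K\in\mathbb R$ and suppose that $(P_t)$ has intertwining curvature bounded below by $K$, that is, there is a strongly continuous semigroup $(\vec P_t)_{t\ge0}$ of linear operators on $F$ such that, for all $t\ge 0$, $s\in\mathbb R$, $\xi\in F$, one has $\vec P_t\partial=\partial P_t$, $\mathcal J\vec P_t=\vec P_t\mathcal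 J$, $\vec P_tV_s=V_s\vec P_t$ and $(\vec P_t\xi|\vec P_t\xi)\le e^{-2Kt}P_t(\xi|\xi)$. Then for every operator mean function $\Lambda$ the gradient estimate $\mathrm{GE}_\Lambda(K,\infty)$ holds: $$\|\partial(P_t(A))\|_{\Lambda,\rho}^2\le e^{-2Kt}\,\|\partial(A)\|_{\Lambda,P_t^\dagger(\rho)}^2$$ for all self-adjoint $A\in M_n(\mathbb C)$, all positive definite $\rho\in M_n(\mathbb C)$ and all $t\ge 0$. -/

import Mathlib

open scoped NNReal Topology MulOpposite ComplexOrder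

/-- The algebra `M_n(ℂ)`. -/
abbrev Mat (n : ℕ) : Type := Matrix (Fin n) (Fin n) ℂ

namespace QMS

noncomputable section

open scoped MatrixOrder
open MulOpposite (op)

/-! ### Matrices -/

/-- The normalized trace `τ` on `M_n(ℂ)`. -/
def tau {n : ℕ} (A : Mat n) : ℂ := (n : ℂ)⁻¹ * A.trace

/-- The complex power `ρ ^ z = exp (z log ρ)` of a positive definite matrix `ρ`. -/
def cpow {n : ℕ} (ρ : Mat n) (z : ℂ) : Mat n := NormedSpace.exp (z • cfc Real.log ρ)

/-- The adjoint `T†` of `T` with respect to the trace pairing; see `tau_map_mul`. -/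
def dagger {n : ℕ} (T : Mat n →ₗ[ℂ] Mat n) (B : Mat n) : Mat n :=
  Matrix.of fun i j => (T (Matrix.single j i 1) * B).trace

/-- The defining property of `T†`: `τ(T(A) B) = τ(A T†(B))`. -/
theorem tau_map_mul {n : ℕ} (T : Mat n →ₗ[ℂ] Mat n) (A B : Mat n) :
    tau (T A * B) = tau (A * dagger T B) := by
  have h : T A = ∑ j, ∑ i, A j i • T (Matrix.single j i 1) := by
    conv_lhs => rw [Matrix.matrix_eq_sum_single A]
    simp only [map_sum]
    refine Finset.sum_congr rfl fun j _ => Finset.sum_congr rfl fun i _ => ?_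
    rw [← map_smul, Matrix.smul_single, smul_eq_mul, mul_one]
  unfold tau
  congr 1
  rw [h]
  simp only [Finset.sum_mul, Matrix.trace_sum, smul_mul_assoc, Matrix.trace_smul, smul_eq_mul]
  simp only [Matrix.trace, Matrix.diag, Matrix.mul_apply, dagger, Matrix.of_apply]

/-! ### Quantum Markov semigroups -/

/-- Complete positivity of a linear map on `M_n(ℂ)`. -/
def IsCompletelyPositive {n : ℕ} (Φ : Mat n →ₗ[ℂ] Mat n) : Prop :=
  ∀ (m : ℕ) (A B : Fin m → Mat n),
    0 ≤ ∑ j, ∑ k, star (B j) * Φ (star (A j) * A k) * B k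

/-- A strongly continuous one-parameter semigroup of linear operators. -/
structure IsContinuousSemigroup {E : Type*} [AddCommGroup E] [Module ℂ E] [TopologicalSpace E]
    (P : ℝ≥0 → E →ₗ[ℂ] E) : Prop where
  zero : P 0 = LinearMap.id
  add : ∀ s t, P (s + t) = P s ∘ₗ P t
  continuous : ∀ x, Continuous fun t => P t x

/-- A quantum Markov semigroup on `M_n(ℂ)`. -/
structure IsQuantumMarkovSemigroup {n : ℕ} (P : ℝ≥0 → Mat n →ₗ[ℂ] Mat n) : Prop where
  semigroup : IsContinuousSemigroup P
  unital : ∀ t, P t 1 = 1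
  completelyPositive : ∀ t, IsCompletelyPositive (P t)

/-- `L` is the generator of `P` with the sign convention `P_t = exp (-t L)`. -/
def IsGenerator {n : ℕ} (P : ℝ≥0 → Mat n →ₗ[ℂ] Mat n) (L : Mat n →ₗ[ℂ] Mat n) : Prop :=
  ∀ A, Filter.Tendsto (fun t : ℝ≥0 => (t : ℝ)⁻¹ • (A - P t A)) (𝓝[>] 0) (𝓝 (L A))

/-- GNS-symmetry with respect to `σ`. -/
def IsGNSSymmetric {n : ℕ} (σ : Mat n) (P : ℝ≥0 → Mat n →ₗ[ℂ] Mat n) : Prop :=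
  ∀ t A B, tau (P t A * B * σ) = tau (A * P t B * σ)

/-- The carré du champ operator of `L`. -/
def carre {n : ℕ} (L : Mat n →ₗ[ℂ] Mat n) (A B : Mat n) : Mat n :=
  (1 / 2 : ℂ) • (star (L A) * B + star A * L B - L (star A * B))

/-! ### First-order differential calculus -/

open scoped Matrix.Norms.L2Operator in
/-- A finite-dimensional Hilbert `C*`-bimodule over `M_n(ℂ)`. The right action is the action of
`(M_n(ℂ))ᵐᵒᵖ`, the inner product is conjugate linear in the first argument, and the norm of `F` is
the norm `‖ξ‖ = ‖(ξ|ξ)‖^{1/2}` of the Hilbert module (with the `C*`-norm of `M_n(ℂ)`). -/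
class HilbertBimodule (n : ℕ) (F : Type*) [NormedAddCommGroup F] [NormedSpace ℂ F]
    [FiniteDimensional ℂ F] [Module (Mat n) F] [Module (Mat n)ᵐᵒᵖ F]
    [IsScalarTower ℂ (Mat n) F] [IsScalarTower ℂ (Mat n)ᵐᵒᵖ F]
    [SMulCommClass (Mat n) (Mat n)ᵐᵒᵖ F] where
  /-- The `M_n(ℂ)`-valued inner product `(ξ|η)`. -/
  ip : F →ₗ⋆[ℂ] F →ₗ[ℂ] Mat n
  ip_smul : ∀ (ξ η : F) (A B : Mat n), ip ξ (A • op B • η) = ip (star A • ξ) η * B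
  ip_nonneg : ∀ ξ : F, 0 ≤ ip ξ ξ
  ip_self_eq_zero : ∀ ξ : F, ip ξ ξ = 0 ↔ ξ = 0
  norm_eq : ∀ ξ : F, ‖ξ‖ = Real.sqrt ‖ip ξ ξ‖

section Calculus

variable {n : ℕ} {F : Type*} [NormedAddCommGroup F] [NormedSpace ℂ F]
  [FiniteDimensional ℂ F] [Module (Mat n) F] [Module (Mat n)ᵐᵒᵖ F]
  [IsScalarTower ℂ (Mat n) F] [IsScalarTower ℂ (Mat n)ᵐᵒᵖ F]
  [SMulCommClass (Mat n) (Mat n)ᵐᵒᵖ F] [HilbertBimodule n F]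

/-- The `M_n(ℂ)`-valued inner product of a Hilbert bimodule. -/
def ip (n : ℕ) {F : Type*} [NormedAddCommGroup F] [NormedSpace ℂ F]
    [FiniteDimensional ℂ F] [Module (Mat n) F] [Module (Mat n)ᵐᵒᵖ F]
    [IsScalarTower ℂ (Mat n) F] [IsScalarTower ℂ (Mat n)ᵐᵒᵖ F]
    [SMulCommClass (Mat n) (Mat n)ᵐᵒᵖ F] [HilbertBimodule n F] (ξ η : F) : Mat n :=
  HilbertBimodule.ip ξ η

/-- A first-order differential calculus `(F, (V_t), J, ∂)` for the generator `L` of a quantum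
Markov semigroup that is GNS-symmetric with respect to `σ`. -/
structure Calculus (σ : Mat n) (L : Mat n →ₗ[ℂ] Mat n) (F : Type*) [NormedAddCommGroup F]
    [NormedSpace ℂ F] [FiniteDimensional ℂ F] [Module (Mat n) F] [Module (Mat n)ᵐᵒᵖ F]
    [IsScalarTower ℂ (Mat n) F] [IsScalarTower ℂ (Mat n)ᵐᵒᵖ F]
    [SMulCommClass (Mat n) (Mat n)ᵐᵒᵖ F] [HilbertBimodule n F] where
  /-- The group `(V_t)`. -/
  V : ℝ → F →ₗ[ℂ] F
  /-- The anti-linear operator `J`. -/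
  J : F →ₗ⋆[ℂ] F
  /-- The derivation `∂`. -/
  d : Mat n →ₗ[ℂ] F
  V_zero : V 0 = LinearMap.id
  V_add : ∀ s t, V (s + t) = V s ∘ₗ V t
  V_continuous : ∀ ξ, Continuous fun t => V t ξ
  V_isometry : ∀ t ξ, ‖V t ξ‖ = ‖ξ‖
  leibniz : ∀ A B : Mat n, d (A * B) = A • d B + op B • d A
  V_smul : ∀ (t : ℝ) (A B : Mat n) (ξ : F), V t (A • op B • ξ) =
    (cpow σ (Complex.I * t) * A * cpow σ (-(Complex.I * t))) •
      op (cpow σ (Complex.I * t) * B * cpow σ (-(Complex.I * t))) • V t ξ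
  J_smul : ∀ (A B : Mat n) (ξ : F), J (A • op B • ξ) =
    (cpow σ (1 / 2) * star B * cpow σ (-(1 / 2))) •
      op (cpow σ (1 / 2) * star A * cpow σ (-(1 / 2))) • J ξ
  J_ip : ∀ ξ η : F, tau (ip n (J ξ) (J η) * σ) = tau (ip n η ξ * σ)
  J_V : ∀ t ξ, J (V t ξ) = V t (J ξ)
  d_modular : ∀ (t : ℝ) (A : Mat n),
    d (cpow σ (Complex.I * t) * A * cpow σ (-(Complex.I * t))) = V t (d A)
  d_star : ∀ A : Mat n, d (cpow σ (1 / 2) * star A * cpow σ (-(1 / 2))) = J (d A)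
  span_eq_top : Submodule.span ℂ {ξ : F | ∃ A B : Mat n, ξ = op B • d A} = ⊤
  carre_eq : ∀ A B : Mat n, carre L A B = ip n (d A) (d B)

/-- `z ↦ W_z` is an analytic extension of `t ↦ V_t` to the complex plane. -/
def IsAnalyticExtension (V : ℝ → F →ₗ[ℂ] F) (W : ℂ → F →ₗ[ℂ] F) : Prop :=
  (∀ ξ, Differentiable ℂ fun z => W z ξ) ∧ ∀ t : ℝ, W t = V t

open Classical in
/-- The analytic extension of `t ↦ V_t` to the complex plane. It is unique if it exists, and it
exists for every strongly continuous group on a finite-dimensional space. -/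
def analyticExtension (V : ℝ → F →ₗ[ℂ] F) : ℂ → F →ₗ[ℂ] F :=
  if h : ∃ W, IsAnalyticExtension V W then h.choose else 0

/-- The bimodule action `ξ ↦ A ξ B` as a linear map. -/
def actBoth (A B : Mat n) : F →ₗ[ℂ] F where
  toFun ξ := A • op B • ξ
  map_add' ξ η := by simp only [smul_add]
  map_smul' c ξ := by
    have hl : ∀ (C : Mat n) (ζ : F), C • c • ζ = c • C • ζ := fun C ζ => by
      rw [← smul_one_smul (Mat n) c ζ, ← smul_one_smul (Mat n) c (C • ζ), smul_smul, smul_smul,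
        mul_smul_comm, smul_mul_assoc, mul_one, one_mul]
    have hr : ∀ (C : (Mat n)ᵐᵒᵖ) (ζ : F), C • c • ζ = c • C • ζ := fun C ζ => by
      rw [← smul_one_smul (Mat n)ᵐᵒᵖ c ζ, ← smul_one_smul (Mat n)ᵐᵒᵖ c (C • ζ), smul_smul,
        smul_smul, mul_smul_comm, smul_mul_assoc, mul_one, one_mul]
    simp only [RingHom.id_apply, hl, hr]

/-- The functional calculus `f(T) = ∑_λ f(λ) E_λ` of an operator `T` on a finite-dimensional space
that is self-adjoint for some inner product; here `E_λ` is the projection onto the eigenspace of the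
eigenvalue `λ`, and `f(T)` is written as `p(T)` for the polynomial `p` that interpolates `f` at the
eigenvalues of `T`. -/
def functionalCalculus (f : ℝ → ℝ) (T : F →ₗ[ℂ] F) : F →ₗ[ℂ] F :=
  Polynomial.aeval T (Lagrange.interpolate (Module.End.finite_hasEigenvalue T).toFinset
    (fun l : ℂ => l) (fun l : ℂ => (f l.re : ℂ)))

namespace Calculus

variable {σ : Mat n} {L : Mat n →ₗ[ℂ] Mat n}

/-- `V^ρ_z ξ = ρ^{iz} σ^{-iz} (V_z ξ) σ^{iz} ρ^{-iz}`. -/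
def Vρ (C : Calculus σ L F) (ρ : Mat n) (z : ℂ) : F →ₗ[ℂ] F :=
  actBoth (cpow ρ (Complex.I * z) * cpow σ (-(Complex.I * z)))
    (cpow σ (Complex.I * z) * cpow ρ (-(Complex.I * z))) ∘ₗ analyticExtension C.V z

/-- `⟨ξ, η⟩_{Λ,ρ} = τ[(ξ | f(V^ρ_{-i}) η) ρ]` with `f(t) = Λ(1, t)`. -/
def innerΛ (C : Calculus σ L F) (Λ : ℝ≥0 → ℝ≥0 → ℝ≥0) (ρ : Mat n) (ξ η : F) : ℂ :=
  tau (ip n ξ (functionalCalculus (fun t => Λ 1 t.toNNReal) (C.Vρ ρ (-Complex.I)) η) * ρ)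

/-- `‖ξ‖_{Λ,ρ} = ⟨ξ, ξ⟩_{Λ,ρ}^{1/2}`. -/
def normΛ (C : Calculus σ L F) (Λ : ℝ≥0 → ℝ≥0 → ℝ≥0) (ρ : Mat n) (ξ : F) : ℝ :=
  Real.sqrt (C.innerΛ Λ ρ ξ ξ).re

/-- The gradient estimate `GE_Λ(K, ∞)`. -/
def GradientEstimate (C : Calculus σ L F) (P : ℝ≥0 → Mat n →ₗ[ℂ] Mat n)
    (Λ : ℝ≥0 → ℝ≥0 → ℝ≥0) (K : ℝ) : Prop :=
  ∀ A : Mat n, IsSelfAdjoint A → ∀ ρ : Mat n, ρ.PosDef → ∀ t : ℝ≥0,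
    C.normΛ Λ ρ (C.d (P t A)) ^ 2 ≤
      Real.exp (-2 * K * t) * C.normΛ Λ (dagger (P t) ρ) (C.d A) ^ 2

/-- Intertwining curvature bounded below by `K`. -/
def HasIntertwiningCurvature (C : Calculus σ L F) (P : ℝ≥0 → Mat n →ₗ[ℂ] Mat n) (K : ℝ) : Prop :=
  ∃ Q : ℝ≥0 → F →ₗ[ℂ] F, IsContinuousSemigroup Q ∧
    (∀ (t : ℝ≥0) A, Q t (C.d A) = C.d (P t A)) ∧
    (∀ (t : ℝ≥0) ξ, C.J (Q t ξ) = Q t (C.J ξ)) ∧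
    (∀ (t : ℝ≥0) (s : ℝ) ξ, Q t (C.V s ξ) = C.V s (Q t ξ)) ∧
    (∀ (t : ℝ≥0) ξ, ip n (Q t ξ) (Q t ξ) ≤ Real.exp (-2 * K * t) • P t (ip n ξ ξ))

end Calculus

end Calculus

/-! ### Operator means -/

/-- `h` is operator monotone on `(0, ∞)`. -/
def IsOperatorMonotone (h : ℝ → ℝ) : Prop :=
  ∀ (m : ℕ) (A B : Mat m), A.PosDef → B.PosDef → B ≤ A → cfc h B ≤ cfc h A

/-- `Λ` is an operator mean function. -/
def IsOperatorMean (Λ : ℝ≥0 → ℝ≥0 → ℝ≥0) : Prop :=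
  Continuous (fun p : ℝ≥0 × ℝ≥0 => Λ p.1 p.2) ∧
    ∃ h : ℝ → ℝ, (∀ x, 0 < x → 0 < h x) ∧ IsOperatorMonotone h ∧ h 1 = 1 ∧
      ∀ s t : ℝ≥0, 0 < s → 0 < t → (Λ s t : ℝ) = s * h (t / s)

end

end QMS

namespace QMS

noncomputable section

open scoped MatrixOrder
open MulOpposite (op)

set_option linter.unusedSectionVars false

/-! ### Polynomial functional calculus for Hermitian matrices. -/

section HermitianCalculus

open Polynomial

variable {ι κ : Type*} [Fintype ι] [DecidableEq ι] [Fintype κ] [DecidableEq κ]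

/-! The squared norm `τ[(ξ|f(V^ρ_{-i})ξ)ρ]` is an operator mean, in the sense of Kubo and Ando, of
two positive definite forms on `F`. The first is `τ((ξ|ξ)ρ)`. The second, `τ((ξ|V^ρ_{-i}ξ)ρ)`,
equals `τ((Sξ|Sξ)ρ)` with `S = J V_{-i/2}` (`Calculus.form_S`). The intertwining semigroup commutes
with `J` and `V`, hence with `S`. So the curvature bound, applied to `ξ` and to `Sξ` and traced
against `ρ`, controls both forms by `e^{-2Kt}` times the corresponding forms for `P_t†ρ`
(`form_map_le`). Means respect such a pair of bounds (`IsPosDefForm.mean_le`); the theorem is the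
case `ξ = ∂A`.

In orthonormal coordinates for the two base forms, that property of means is Hansen's inequality
(`IsOperatorMonotone.conj_cfc_le`): `C*C ≤ 1` and `C*AC ≤ A'` imply `C*h(A)C ≤ h(A')`. It follows
from operator monotonicity by dilating `C` to an isometry and pinching, with a loss that tends to
zero.

On the bimodule side, the norm isometries `V_t` have to be shown unitary for `τ((·|·)σ)`
(`Calculus.ip_V_self`, `Calculus.form_V`). The identities for complex `z` then follow from those on
the real line by the identity theorem for entire functions. -/

theorem cfc_eq_aeval {A : Matrix ι ι ℂ} (hA : A.IsHermitian) (f : ℝ → ℝ) (p : ℂ[X])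
    (hp : ∀ i, p.eval (hA.eigenvalues i : ℂ) = (f (hA.eigenvalues i) : ℂ)) :
    cfc f A = aeval A p := by
  rw [hA.cfc_eq, Matrix.IsHermitian.cfc]
  conv_rhs => rw [hA.spectral_theorem]
  have h := Polynomial.aeval_algHom_apply
    ((Unitary.conjStarAlgAut ℂ (Matrix ι ι ℂ) hA.eigenvectorUnitary).toAlgEquiv.toAlgHom)
    (Matrix.diagonal (RCLike.ofReal ∘ hA.eigenvalues : ι → ℂ)) p
  refine Eq.trans ?_ h.symm
  have h2 := Polynomial.aeval_algHom_apply (Matrix.diagonalAlgHom (n := ι) (α := ℂ) ℂ)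
    (RCLike.ofReal ∘ hA.eigenvalues : ι → ℂ) p
  simp only [Matrix.diagonalAlgHom_apply] at h2
  rw [h2]
  have h3 : aeval (RCLike.ofReal ∘ hA.eigenvalues : ι → ℂ) p
      = (RCLike.ofReal ∘ f ∘ hA.eigenvalues : ι → ℂ) := by
    funext i
    rw [Polynomial.aeval_fn_apply, Polynomial.coe_aeval_eq_eval]
    exact hp i
  rw [h3]
  rfl

theorem exists_eval_eq (f : ℝ → ℝ) (s : Finset ℝ) :
    ∃ p : ℂ[X], ∀ x ∈ s, p.eval (x : ℂ) = (f x : ℂ) :=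
  ⟨Lagrange.interpolate s (fun x : ℝ => (x : ℂ)) (fun x => (f x : ℂ)), fun _ hx =>
    Lagrange.eval_interpolate_at_node _ Complex.ofReal_injective.injOn hx⟩

theorem exists_cfc_eq_aeval {A : Matrix ι ι ℂ} {B : Matrix κ κ ℂ} (hA : A.IsHermitian)
    (hB : B.IsHermitian) (f : ℝ → ℝ) :
    ∃ p : ℂ[X], cfc f A = aeval A p ∧ cfc f B = aeval B p := by
  obtain ⟨p, hp⟩ := exists_eval_eq f
    (Finset.univ.image hA.eigenvalues ∪ Finset.univ.image hB.eigenvalues)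
  exact ⟨p, cfc_eq_aeval hA f p fun i => hp _ (by simp),
    cfc_eq_aeval hB f p fun i => hp _ (by simp)⟩

theorem aeval_mul_eq_mul_aeval {A : Matrix ι ι ℂ} {B : Matrix κ κ ℂ} {W : Matrix ι κ ℂ}
    (h : A * W = W * B) (p : ℂ[X]) : aeval A p * W = W * aeval B p := by
  induction p using Polynomial.induction_on' with
  | add p q hp hq => simp only [map_add, Matrix.add_mul, Matrix.mul_add, hp, hq]
  | monomial k c =>
    have hk : A ^ k * W = W * B ^ k := by
      induction k with
      | zero => simp
      | succ k ih => rw [pow_succ, pow_succ', Matrix.mul_assoc, h, ← Matrix.mul_assoc, ih,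
          Matrix.mul_assoc, ← pow_succ, ← pow_succ']
    simp only [aeval_monomial, Algebra.algebraMap_eq_smul_one, smul_mul_assoc, one_mul,
      Matrix.smul_mul, Matrix.mul_smul, hk]

/-- A single polynomial interpolates `f` on both spectra, and polynomials respect intertwining
relations. Since `W` may be rectangular, this covers reindexing, block inclusions and compressions
alike. -/
theorem cfc_mul_eq_mul_cfc {A : Matrix ι ι ℂ} {B : Matrix κ κ ℂ} {W : Matrix ι κ ℂ}
    (hA : A.IsHermitian) (hB : B.IsHermitian) (h : A * W = W * B) (f : ℝ → ℝ) :
    cfc f A * W = W * cfc f B := by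
  obtain ⟨p, h1, h2⟩ := exists_cfc_eq_aeval hA hB f
  rw [h1, h2, aeval_mul_eq_mul_aeval h]

theorem cfc_submatrix {A : Matrix ι ι ℂ} (hA : A.IsHermitian) (e : κ ≃ ι) (f : ℝ → ℝ) :
    cfc f (A.submatrix e e) = (cfc f A).submatrix e e := by
  have h := cfc_mul_eq_mul_cfc (W := (1 : Matrix ι ι ℂ).submatrix e id) (hA.submatrix e) hA
    (by rw [Matrix.submatrix_mul_equiv]; ext; simp [Matrix.mul_apply, Matrix.one_apply]) f
  have h' := congrArg (· * (1 : Matrix ι ι ℂ).submatrix id e) h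
  have h1 : (1 : Matrix ι ι ℂ).submatrix e id * (1 : Matrix ι ι ℂ).submatrix id e = 1 := by
    ext; simp [Matrix.mul_apply, Matrix.one_apply]
  simp only [Matrix.mul_assoc, h1, Matrix.mul_one] at h'
  rw [h']
  ext; simp [Matrix.mul_apply, Matrix.one_apply]

theorem le_iff_dotProduct {A B : Matrix ι ι ℂ} (hA : A.IsHermitian) (hB : B.IsHermitian) :
    A ≤ B ↔ ∀ x : ι → ℂ, star x ⬝ᵥ A.mulVec x ≤ star x ⬝ᵥ B.mulVec x := by
  rw [Matrix.le_iff, Matrix.posSemidef_iff_dotProduct_mulVec]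
  simp only [Matrix.sub_mulVec, dotProduct_sub, sub_nonneg]
  exact ⟨fun h => h.2, fun h => ⟨hB.sub hA, h⟩⟩

theorem isHermitian_cfc (f : ℝ → ℝ) (A : Matrix ι ι ℂ) : (cfc f A).IsHermitian :=
  cfc_predicate f A

theorem posDef_of_le {A B : Matrix ι ι ℂ} (hA : A.PosDef) (h : A ≤ B) : B.PosDef := by
  have := hA.add_posSemidef (Matrix.le_iff.1 h)
  rwa [add_sub_cancel] at this

theorem conj_le_conj {A B : Matrix ι ι ℂ} (h : A ≤ B) (V : Matrix ι κ ℂ) :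
    V.conjTranspose * A * V ≤ V.conjTranspose * B * V := by
  rw [Matrix.le_iff] at h ⊢
  have := h.conjTranspose_mul_mul_same V
  rwa [Matrix.mul_sub, Matrix.sub_mul] at this

/-! ### Hansen's inequality from operator monotonicity. -/

namespace IsOperatorMonotone

variable {h : ℝ → ℝ}

/-- Operator monotonicity is defined for matrices indexed by `Fin m`; the dilation argument needs
sums of index types, so it is transported along a reindexing. -/
theorem cfc_le (hh : IsOperatorMonotone h) {A B : Matrix ι ι ℂ} (hA : A.PosDef) (hAB : A ≤ B) :
    cfc h A ≤ cfc h B := by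
  have hB := posDef_of_le hA hAB
  let e := (Fintype.equivFin ι).symm
  have h1 := hh _ (B.submatrix e e) (A.submatrix e e) (hB.submatrix e.injective)
    (hA.submatrix e.injective) (by
      rw [Matrix.le_iff] at hAB ⊢
      exact hAB.submatrix e)
  rw [cfc_submatrix hA.isHermitian, cfc_submatrix hB.isHermitian, Matrix.le_iff] at h1
  rw [Matrix.le_iff]
  have h2 := h1.submatrix e.symm
  convert h2 using 1
  ext i j
  simp

/-- Pinching: `X ≤ (1 + δ) PXP + (1 + δ⁻¹) (1 - P) X (1 - P)`. -/
theorem le_pinching {X P : Matrix ι ι ℂ} (hX : X.PosSemidef) (hP : P.IsHermitian) {δ : ℝ}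
    (hδ : 0 < δ) :
    X ≤ ((1 + δ : ℝ) : ℂ) • (P * X * P) +
      ((1 + δ⁻¹ : ℝ) : ℂ) • ((1 - P) * X * (1 - P)) := by
  let s : ℂ := ((Real.sqrt δ : ℝ) : ℂ)
  have hs : s * s = (δ : ℂ) := by
    rw [← Complex.ofReal_mul, Real.mul_self_sqrt hδ.le]
  have hs0 : s ≠ 0 := by
    intro h0
    rw [h0, zero_mul] at hs
    exact hδ.ne (by exact_mod_cast hs)
  have hstar : star s = s := Complex.conj_ofReal _
  rw [Matrix.le_iff]
  have h1 := hX.conjTranspose_mul_mul_same (s • P - s⁻¹ • (1 - P))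
  have h2 : (s • P - s⁻¹ • (1 - P)).conjTranspose = s • P - s⁻¹ • (1 - P) := by
    rw [Matrix.conjTranspose_sub, Matrix.conjTranspose_smul, Matrix.conjTranspose_smul,
      Matrix.conjTranspose_sub, Matrix.conjTranspose_one, hP.eq, star_inv₀, hstar]
  rw [h2] at h1
  have h3 : X = (P + (1 - P)) * X * (P + (1 - P)) := by simp
  generalize hQ : 1 - P = Q at *
  have hd : ((1 + δ : ℝ) : ℂ) = 1 + s * s := by rw [hs]; push_cast; rfl
  have hd' : ((1 + δ⁻¹ : ℝ) : ℂ) = 1 + s⁻¹ * s⁻¹ := by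
    rw [← mul_inv, hs]; push_cast; rfl
  -- With `s = √δ`, the gap in the inequality is exactly a congruence of `X`; the cross terms `PXQ`
  -- and `QXP` match because `s s⁻¹ = 1`.
  have key : (1 + s * s) • (P * X * P) + (1 + s⁻¹ * s⁻¹) • (Q * X * Q) -
      (P + Q) * X * (P + Q) = (s • P - s⁻¹ • Q) * X * (s • P - s⁻¹ • Q) := by
    simp only [add_mul, mul_add, sub_mul, mul_sub, smul_mul_assoc, mul_smul_comm, smul_sub,
      smul_smul, inv_mul_cancel₀ hs0, mul_inv_cancel₀ hs0, add_smul, one_smul]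
    abel
  rw [← h3] at key
  rw [hd, hd', key]
  exact h1

/-- Pinching by the range projection of `V` replaces `X` by a larger block diagonal `Y`, and `V`
intertwines `Y` with its corner, so `h` passes through the compression. The factor `1 + δ` is the
price of removing the off-diagonal blocks. -/
theorem compression_le (hh : IsOperatorMonotone h) {X : Matrix ι ι ℂ} (hX : X.PosDef)
    {V : Matrix ι κ ℂ} (hV : V.conjTranspose * V = 1) {δ : ℝ} (hδ : 0 < δ) :
    V.conjTranspose * cfc h X * V ≤
      cfc h (((1 + δ : ℝ) : ℂ) • (V.conjTranspose * X * V)) := by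
  let P := V * V.conjTranspose
  have hP : P.IsHermitian := Matrix.isHermitian_mul_conjTranspose_self V
  have hPV : P * V = V := by rw [Matrix.mul_assoc, hV, Matrix.mul_one]
  set Y := ((1 + δ : ℝ) : ℂ) • (P * X * P) + ((1 + δ⁻¹ : ℝ) : ℂ) • ((1 - P) * X * (1 - P)) with hY
  have hXY : X ≤ Y := le_pinching hX.posSemidef hP hδ
  have hYp := posDef_of_le hX hXY
  have hZ : (((1 + δ : ℝ) : ℂ) • (V.conjTranspose * X * V)).IsHermitian := by
    rw [Matrix.IsHermitian, Matrix.conjTranspose_smul,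
      (Matrix.isHermitian_conjTranspose_mul_mul V hX.isHermitian).eq]
    congr 1
    exact Complex.conj_ofReal _
  have hYV : Y * V = V * (((1 + δ : ℝ) : ℂ) • (V.conjTranspose * X * V)) := by
    have hPV' : (1 - P) * V = 0 := by rw [Matrix.sub_mul, Matrix.one_mul, hPV, sub_self]
    rw [hY, Matrix.add_mul, Matrix.smul_mul, Matrix.smul_mul, Matrix.mul_assoc _ P V, hPV,
      Matrix.mul_assoc _ (1 - P) V, hPV', Matrix.mul_zero, smul_zero, add_zero, Matrix.mul_smul]
    simp only [P, Matrix.mul_assoc]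
  have h1 := conj_le_conj (hh.cfc_le hX hXY) V
  rwa [Matrix.mul_assoc _ (cfc h Y), cfc_mul_eq_mul_cfc hYp.isHermitian hZ hYV h,
    ← Matrix.mul_assoc _ V, hV, Matrix.one_mul] at h1

theorem _root_.Matrix.PosDef.pos_of_mem_spectrum {A : Matrix ι ι ℂ} (hA : A.PosDef) {x : ℝ}
    (hx : x ∈ spectrum ℝ A) : 0 < x :=
  (Matrix.isStrictlyPositive_iff_posDef.2 hA).spectrum_pos hx

theorem cfc_nonneg_of_pos (hpos : ∀ x, 0 < x → 0 < h x) {A : Matrix ι ι ℂ} (hA : A.PosDef) :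
    0 ≤ cfc h A :=
  cfc_nonneg fun _ hx => (hpos _ (hA.pos_of_mem_spectrum hx)).le

theorem tendsto_cfc {α : Type*} {l : Filter α} {A : Matrix ι ι ℂ} (hA : A.IsHermitian)
    {g : α → ℝ → ℝ} (hg : ∀ x ∈ spectrum ℝ A, Filter.Tendsto (fun a => g a x) l (𝓝 (h x))) :
    Filter.Tendsto (fun a => cfc (g a) A) l (𝓝 (cfc h A)) := by
  simp only [hA.cfc_eq, Matrix.IsHermitian.cfc, Unitary.conjStarAlgAut_apply]
  refine Filter.Tendsto.mul_const _ (Filter.Tendsto.const_mul _ ?_)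
  refine (continuous_id.matrix_diagonal.tendsto _).comp (tendsto_pi_nhds.2 fun i => ?_)
  exact (Complex.continuous_ofReal.tendsto _).comp
    (hg _ (hA.eigenvalues_mem_spectrum_real i))

/-- Hansen's inequality, for a contraction `C` and `A'` dominating `C* A C`. -/
theorem conj_cfc_le (hh : IsOperatorMonotone h) (hpos : ∀ x, 0 < x → 0 < h x)
    (hc : ContinuousOn h (Set.Ioi 0)) {A : Matrix ι ι ℂ} {A' : Matrix κ κ ℂ} (hA : A.PosDef)
    (hA' : A'.PosDef) {C : Matrix ι κ ℂ} (hC : C.conjTranspose * C ≤ 1)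
    (hCA : C.conjTranspose * A * C ≤ A') :
    C.conjTranspose * cfc h A * C ≤ cfc h A' := by
  -- The defect operator of the contraction `C`: stacking `C` over `D` gives an isometry.
  obtain ⟨D, hD⟩ : ∃ D : Matrix κ κ ℂ, D.conjTranspose * D = 1 - C.conjTranspose * C := by
    obtain ⟨D, hD⟩ := CStarAlgebra.nonneg_iff_eq_star_mul_self.1 (sub_nonneg.2 hC)
    exact ⟨D, hD.symm⟩
  have hD1 : D.conjTranspose * D ≤ 1 := by
    rw [hD, Matrix.le_iff, sub_sub_cancel]
    exact Matrix.posSemidef_conjTranspose_mul_self C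
  have key : ∀ ε : ℝ, 0 < ε → C.conjTranspose * cfc h A * C ≤
      cfc (fun x => h ((1 + ε) * (x + ε))) A' := by
    intro ε hε
    have hεC : (0 : ℂ) < ((ε : ℝ) : ℂ) := by exact_mod_cast hε
    have hE : ((ε : ℂ) • (1 : Matrix κ κ ℂ)).PosDef := Matrix.PosDef.one.smul hεC
    -- The second block is `ε` rather than `0` because `h` is controlled only on `(0, ∞)`.
    let X : Matrix (ι ⊕ κ) (ι ⊕ κ) ℂ := Matrix.fromBlocks A 0 0 ((ε : ℂ) • 1)
    let V : Matrix (ι ⊕ κ) κ ℂ := Matrix.fromRows C D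
    let I₁ : Matrix (ι ⊕ κ) ι ℂ := Matrix.fromRows 1 0
    let I₂ : Matrix (ι ⊕ κ) κ ℂ := Matrix.fromRows 0 1
    have hX : X.PosDef := by
      have := hA.isUnit.invertible
      have hX0 : X.PosSemidef := by
        have := (Matrix.PosDef.fromBlocks₁₁ (0 : Matrix ι κ ℂ) ((ε : ℂ) • 1) hA).2
          (by simpa using hE.posSemidef)
        rw [Matrix.conjTranspose_zero] at this
        exact this
      refine (hX0.posDef_iff_det_ne_zero).2 ?_
      rw [Matrix.det_fromBlocks_zero₁₂]
      exact mul_ne_zero hA.det_pos.ne' hE.det_pos.ne'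
    have hV : V.conjTranspose * V = 1 := by
      simp only [V, Matrix.conjTranspose_fromRows_eq_fromCols_conjTranspose,
        Matrix.fromCols_mul_fromRows, hD, add_sub_cancel]
    have hV' : V = I₁ * C + I₂ * D := by
      ext (i | i) j <;> simp [V, I₁, I₂, Matrix.fromRows_mul]
    have h1 : cfc h X * I₁ = I₁ * cfc h A := cfc_mul_eq_mul_cfc hX.isHermitian hA.isHermitian
      (by simp [X, I₁, Matrix.fromBlocks_mul_fromRows, Matrix.fromRows_mul]) h
    have h2 : cfc h X * I₂ = I₂ * cfc h ((ε : ℂ) • (1 : Matrix κ κ ℂ)) :=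
      cfc_mul_eq_mul_cfc hX.isHermitian hE.isHermitian
        (by ext (i | i) j <;> simp [X, I₂, Matrix.fromBlocks_mul_fromRows]) h
    have hVX : V.conjTranspose * cfc h X * V = C.conjTranspose * cfc h A * C +
        D.conjTranspose * cfc h ((ε : ℂ) • (1 : Matrix κ κ ℂ)) * D := by
      conv_lhs => rw [Matrix.mul_assoc, hV', Matrix.mul_add, ← Matrix.mul_assoc, h1,
        ← Matrix.mul_assoc (cfc h X), h2, ← hV']
      simp [V, I₁, I₂, Matrix.conjTranspose_fromRows_eq_fromCols_conjTranspose,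
        Matrix.fromRows_mul, Matrix.fromCols_mul_fromRows, Matrix.mul_add, Matrix.mul_assoc]
    have hVXV : V.conjTranspose * X * V = C.conjTranspose * A * C +
        (ε : ℂ) • (D.conjTranspose * D) := by
      simp [V, X, Matrix.conjTranspose_fromRows_eq_fromCols_conjTranspose,
        Matrix.fromBlocks_mul_fromRows, Matrix.fromCols_mul_fromRows, Matrix.mul_assoc]
    have hVXp : (V.conjTranspose * X * V).PosDef := by
      refine hX.conjTranspose_mul_mul_same fun x y hxy => ?_
      have := congrArg (V.conjTranspose.mulVec) hxy
      simpa [Matrix.mulVec_mulVec, hV] using this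
    have hd : (0 : ℂ) < ((1 + ε : ℝ) : ℂ) := by exact_mod_cast (by linarith : 0 < 1 + ε)
    have hZ : cfc (fun x => (1 + ε) * (x + ε)) A' = ((1 + ε : ℝ) : ℂ) • (A' + (ε : ℂ) • 1) := by
      rw [cfc_eq_aeval hA'.isHermitian _
        (Polynomial.C ((1 + ε : ℝ) : ℂ) * (Polynomial.X + Polynomial.C (ε : ℂ)))
        fun i => by simp]
      simp only [map_mul, map_add, Polynomial.aeval_C, Polynomial.aeval_X,
        Algebra.algebraMap_eq_smul_one, smul_mul_assoc, one_mul]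
    have hle : ((1 + ε : ℝ) : ℂ) • (V.conjTranspose * X * V) ≤
        ((1 + ε : ℝ) : ℂ) • (A' + (ε : ℂ) • 1) := by
      rw [Matrix.le_iff, ← smul_sub, hVXV, add_sub_add_comm, ← smul_sub]
      exact ((Matrix.le_iff.1 hCA).add ((Matrix.le_iff.1 hD1).smul hεC.le)).smul hd.le
    -- The discarded term `D* h(ε) D` is positive because `h(ε) > 0`; the pinching parameter is also
    -- taken to be `ε`.
    calc C.conjTranspose * cfc h A * C ≤ V.conjTranspose * cfc h X * V := by
          rw [hVX, Matrix.le_iff, add_sub_cancel_left]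
          exact (Matrix.nonneg_iff_posSemidef.1
            (cfc_nonneg_of_pos hpos hE)).conjTranspose_mul_mul_same D
      _ ≤ cfc h (((1 + ε : ℝ) : ℂ) • (V.conjTranspose * X * V)) := hh.compression_le hX hV hε
      _ ≤ cfc h (((1 + ε : ℝ) : ℂ) • (A' + (ε : ℂ) • 1)) := hh.cfc_le (hVXp.smul hd) hle
      _ = _ := by
        rw [← hZ, ← cfc_comp' h (fun x => (1 + ε) * (x + ε)) A'
          ((Set.Finite.image _ Matrix.finite_real_spectrum).continuousOn _)]
  -- Only the function varies with `ε`, so convergence at the finitely many points of the spectrum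
  -- of `A'` is enough.
  have hlim : Filter.Tendsto (fun ε : ℝ => cfc (fun x => h ((1 + ε) * (x + ε))) A') (𝓝[>] 0)
      (𝓝 (cfc h A')) := by
    refine tendsto_cfc hA'.isHermitian fun x hx => ?_
    have hx0 := hA'.pos_of_mem_spectrum hx
    have h1 : Filter.Tendsto (fun ε : ℝ => (1 + ε) * (x + ε)) (𝓝 0) (𝓝 x) := by
      have : Continuous fun ε : ℝ => (1 + ε) * (x + ε) := by fun_prop
      simpa using this.tendsto 0
    exact ((hc.continuousAt (Ioi_mem_nhds hx0)).tendsto.comp h1).mono_left nhdsWithin_le_nhds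
  rw [le_iff_dotProduct (Matrix.isHermitian_conjTranspose_mul_mul C (isHermitian_cfc h A))
    (isHermitian_cfc h A')]
  intro x
  have hcont : Continuous fun M : Matrix κ κ ℂ => star x ⬝ᵥ M.mulVec x := by fun_prop
  refine ge_of_tendsto ((hcont.tendsto _).comp hlim) ?_
  filter_upwards [self_mem_nhdsWithin] with ε hε
  exact (le_iff_dotProduct (Matrix.isHermitian_conjTranspose_mul_mul C (isHermitian_cfc h A))
    (isHermitian_cfc _ A')).1 (key ε hε) x

end IsOperatorMonotone

end HermitianCalculus

/-! ### Operator means of positive definite forms. -/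

section Forms

open Polynomial Module

/-- A Hermitian positive definite sesquilinear form. -/
structure IsPosDefForm {E : Type*} [AddCommGroup E] [Module ℂ E] (B : E →ₗ⋆[ℂ] E →ₗ[ℂ] ℂ) :
    Prop where
  conj_symm : ∀ x y, star (B y x) = B x y
  nonneg : ∀ x, 0 ≤ B x x
  definite : ∀ x, B x x = 0 → x = 0

theorem IsPosDefForm.exists_equiv {E : Type*} [AddCommGroup E] [Module ℂ E]
    [FiniteDimensional ℂ E] {B : E →ₗ⋆[ℂ] E →ₗ[ℂ] ℂ} (hB : IsPosDefForm B) :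
    ∃ S : E ≃ₗ[ℂ] (Fin (finrank ℂ E) → ℂ), ∀ x y, B x y = star (S x) ⬝ᵥ S y := by
  let core : InnerProductSpace.Core ℂ E :=
    { inner := fun x y => B x y
      conj_inner_symm := hB.conj_symm
      re_inner_nonneg := fun x => (Complex.le_def.1 (hB.nonneg x)).1
      add_left := fun x y z => by simp
      smul_left := fun x y r => by simp
      definite := hB.definite }
  let : NormedAddCommGroup E := core.toNormedAddCommGroup
  let : InnerProductSpace ℂ E := InnerProductSpace.ofCore core.toCore
  let b := stdOrthonormalBasis ℂ E
  refine ⟨b.repr.toLinearEquiv.trans (WithLp.linearEquiv 2 ℂ _), fun x y => ?_⟩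
  have h : B x y = inner ℂ x y := rfl
  rw [h, ← b.repr.inner_map_map, PiLp.inner_apply]
  simp [dotProduct, mul_comm]

variable {F : Type*} [NormedAddCommGroup F] [NormedSpace ℂ F] [FiniteDimensional ℂ F]

/-- An operator that is positive for `B` is a positive definite matrix in suitable coordinates. -/
theorem IsPosDefForm.exists_model {B : F →ₗ⋆[ℂ] F →ₗ[ℂ] ℂ} (hB : IsPosDefForm B)
    {D : F →ₗ[ℂ] F} (hD : IsPosDefForm (B.compl₂ D)) :
    ∃ (S : F ≃ₗ[ℂ] (Fin (finrank ℂ F) → ℂ)) (A : Mat (finrank ℂ F)), A.PosDef ∧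
      (∀ x y, B x y = star (S x) ⬝ᵥ S y) ∧ (∀ x, S (D x) = A.mulVec (S x)) ∧
      ∀ f x, S (functionalCalculus f D x) = (cfc f A).mulVec (S x) := by
  obtain ⟨S, hS⟩ := hB.exists_equiv
  let A : Mat (finrank ℂ F) := LinearMap.toMatrix' (S.toLinearMap ∘ₗ D ∘ₗ S.symm.toLinearMap)
  have hSA : ∀ x, S (D x) = A.mulVec (S x) := fun x => by
    rw [← Matrix.toLin'_apply, Matrix.toLin'_toMatrix']
    simp
  have hBD : ∀ x y, B.compl₂ D x y = star (S x) ⬝ᵥ A.mulVec (S y) := fun x y => by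
    rw [LinearMap.compl₂_apply, hS, hSA]
  have hH : A.IsHermitian := by
    ext i j
    have h := hD.conj_symm (S.symm (Pi.single i 1)) (S.symm (Pi.single j 1))
    rw [hBD, hBD] at h
    simpa using h
  have hA : A.PosDef := by
    refine Matrix.PosDef.of_dotProduct_mulVec_pos hH fun v hv => ?_
    have h := hBD (S.symm v) (S.symm v)
    rw [S.apply_symm_apply] at h
    rw [← h]
    refine lt_of_le_of_ne (hD.nonneg _) fun h0 => hv ?_
    have := hD.definite _ h0.symm
    simpa using this
  refine ⟨S, A, hA, hS, hSA, fun f x => ?_⟩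
  have haeval : ∀ (p : ℂ[X]) x, S (aeval D p x) = (aeval A p).mulVec (S x) := by
    intro p
    induction p using Polynomial.induction_on' with
    | add p q hp hq => intro x; simp [Matrix.add_mulVec, hp, hq]
    | monomial k c =>
      have hk : ∀ x, S ((D ^ k) x) = (A ^ k).mulVec (S x) := by
        induction k with
        | zero => simp
        | succ k ih =>
          intro x
          rw [pow_succ, pow_succ, Module.End.mul_apply, ih, hSA, Matrix.mulVec_mulVec]
      intro x
      simp only [aeval_monomial, Algebra.algebraMap_eq_smul_one, smul_mul_assoc, one_mul,
        LinearMap.smul_apply, map_smul, Matrix.smul_mulVec, hk]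
  rw [functionalCalculus, haeval, cfc_eq_aeval hH f]
  intro i
  -- Eigenvalues of `A` are eigenvalues of `D` through `S`, hence among the interpolation nodes that
  -- define `functionalCalculus`.
  have hmem : (hH.eigenvalues i : ℂ) ∈ (Module.End.finite_hasEigenvalue D).toFinset := by
    rw [Set.Finite.mem_toFinset]
    let v : Fin (finrank ℂ F) → ℂ := ⇑(hH.eigenvectorBasis i)
    have hv : v ≠ 0 := fun h0 => hH.eigenvectorBasis.toBasis.ne_zero i
      (by simpa [v] using h0)
    refine Module.End.hasEigenvalue_of_hasEigenvector (x := S.symm v)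
      ⟨Module.End.mem_eigenspace_iff.2 (S.injective ?_), by simpa using hv⟩
    rw [hSA, map_smul, S.apply_symm_apply]
    exact hH.mulVec_eigenvectorBasis i
  exact Lagrange.eval_interpolate_at_node (v := fun l : ℂ => l) (fun l : ℂ => (f l.re : ℂ))
    Function.injective_id.injOn hmem

/-- Monotonicity and the transformer inequality for the operator mean of a pair of positive
definite forms, where the second form is represented with respect to the first one. -/
theorem IsPosDefForm.mean_le {h f : ℝ → ℝ} (hh : IsOperatorMonotone h)
    (hpos : ∀ x, 0 < x → 0 < h x) (hc : ContinuousOn h (Set.Ioi 0))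
    (hf : ∀ x, 0 < x → f x = h x)
    {B B' : F →ₗ⋆[ℂ] F →ₗ[ℂ] ℂ} (hB : IsPosDefForm B) (hB' : IsPosDefForm B')
    {D D' : F →ₗ[ℂ] F} (hD : IsPosDefForm (B.compl₂ D)) (hD' : IsPosDefForm (B'.compl₂ D'))
    (Q : F →ₗ[ℂ] F) {c : ℝ} (hc0 : 0 < c)
    (h1 : ∀ x, B (Q x) (Q x) ≤ c * B' x x)
    (h2 : ∀ x, B (Q x) (D (Q x)) ≤ c * B' x (D' x)) (x : F) :
    B (Q x) (functionalCalculus f D (Q x)) ≤ c * B' x (functionalCalculus f D' x) := by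
  obtain ⟨S, A, hA, hS, hSD, hSf⟩ := hB.exists_model hD
  obtain ⟨S', A', hA', hS', hSD', hSf'⟩ := hB'.exists_model hD'
  -- Scaling the matrix of `Q` by `c^{-1/2}` absorbs the constant, so that `h1` says that `C` is a
  -- contraction and `h2` that `C*AC ≤ A'`.
  let r : ℝ := (Real.sqrt c)⁻¹
  have hr : ((r : ℝ) : ℂ) * (r : ℂ) * (c : ℂ) = 1 := by
    have : r * r * c = 1 := by
      rw [← mul_inv, Real.mul_self_sqrt hc0.le, inv_mul_cancel₀ hc0.ne']
    exact_mod_cast this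
  have hr0 : (0 : ℂ) ≤ (r : ℂ) * (r : ℂ) := by
    exact_mod_cast mul_self_nonneg r
  let C : Mat (finrank ℂ F) :=
    (r : ℂ) • LinearMap.toMatrix' (S.toLinearMap ∘ₗ Q ∘ₗ S'.symm.toLinearMap)
  have hC : ∀ y, C.mulVec (S' y) = (r : ℂ) • S (Q y) := fun y => by
    rw [Matrix.smul_mulVec, ← Matrix.toLin'_apply, Matrix.toLin'_toMatrix']
    simp
  have hquad : ∀ (M : Mat (finrank ℂ F)) y, star (S' y) ⬝ᵥ
      (C.conjTranspose * M * C).mulVec (S' y) =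
        (r : ℂ) * r * (star (S (Q y)) ⬝ᵥ M.mulVec (S (Q y))) := fun M y => by
    rw [← Matrix.mulVec_mulVec, ← Matrix.mulVec_mulVec, hC, Matrix.dotProduct_mulVec,
      ← Matrix.star_mulVec, hC, Matrix.mulVec_smul, star_smul, smul_dotProduct, dotProduct_smul,
      smul_smul, smul_eq_mul, Complex.star_def, Complex.conj_ofReal]
  have hle : ∀ {M N : Mat (finrank ℂ F)}, M.IsHermitian → N.IsHermitian →
      (C.conjTranspose * M * C ≤ N ↔ ∀ y, star (S (Q y)) ⬝ᵥ M.mulVec (S (Q y)) ≤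
        c * (star (S' y) ⬝ᵥ N.mulVec (S' y))) := fun {M N} hM hN => by
    rw [le_iff_dotProduct (Matrix.isHermitian_conjTranspose_mul_mul C hM) hN]
    refine ⟨fun H y => ?_, fun H v => ?_⟩
    · have := mul_le_mul_of_nonneg_left (H (S' y)) (by exact_mod_cast hc0.le : (0 : ℂ) ≤ (c : ℂ))
      rwa [hquad, ← mul_assoc, mul_comm (c : ℂ), hr, one_mul] at this
    · obtain ⟨y, rfl⟩ := S'.surjective v
      have := mul_le_mul_of_nonneg_left (H y) hr0
      rwa [← mul_assoc, hr, one_mul, ← hquad] at this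
  have key := hh.conj_cfc_le hpos hc hA hA' (C := C)
    (by
      have := (hle (M := 1) (N := 1) Matrix.isHermitian_one Matrix.isHermitian_one).2
        (fun y => by simpa only [Matrix.one_mulVec, ← hS, ← hS'] using h1 y)
      rwa [Matrix.mul_one] at this)
    ((hle hA.isHermitian hA'.isHermitian).2 fun y => by
      simpa only [← hSD, ← hSD', ← hS, ← hS'] using h2 y)
  have hfh : ∀ {M : Mat (finrank ℂ F)}, M.PosDef → cfc f M = cfc h M := fun hM =>
    cfc_congr fun x hx => hf x (hM.pos_of_mem_spectrum hx)
  have := (hle (isHermitian_cfc h A) (isHermitian_cfc h A')).1 key x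
  rwa [← hfh hA, ← hfh hA', ← hSf, ← hSf', ← hS, ← hS'] at this

/-- Ensures that squaring the real square root in `normΛ` recovers the real part of the form. -/
theorem IsPosDefForm.mean_nonneg {f : ℝ → ℝ} (hf : ∀ x, 0 ≤ f x)
    {B : F →ₗ⋆[ℂ] F →ₗ[ℂ] ℂ} (hB : IsPosDefForm B) {D : F →ₗ[ℂ] F}
    (hD : IsPosDefForm (B.compl₂ D)) (x : F) : 0 ≤ B x (functionalCalculus f D x) := by
  obtain ⟨S, A, hA, hS, hSD, hSf⟩ := hB.exists_model hD
  rw [hS, hSf]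
  exact (Matrix.nonneg_iff_posSemidef.1 (cfc_nonneg fun x _ => hf x)).dotProduct_mulVec_nonneg _

end Forms

/-! ### Polarization of sesquilinear maps. -/

section Polarization

variable {E G : Type*} [AddCommGroup E] [Module ℂ E] [AddCommGroup G] [Module ℂ G]

theorem sesquilinear_eq_zero_of_diag {f : E →ₗ⋆[ℂ] E →ₗ[ℂ] G} (h : ∀ x, f x x = 0) (x y : E) :
    f x y = 0 := by
  have h1 := h (x + y)
  have h2 := h (x + Complex.I • y)
  simp only [map_add, LinearMap.add_apply, LinearMap.map_smulₛₗ, LinearMap.smul_apply, h,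
    map_smul, zero_add, add_zero, smul_zero, Complex.conj_I] at h1 h2
  have h3 : f x y = f y x := by
    have := congrArg (fun v => (-Complex.I) • v) h2
    simp only [smul_add, smul_smul, smul_zero] at this
    exact (neg_add_eq_zero.1 (by simpa using this)).symm
  rw [← h3, ← two_smul ℂ] at h1
  exact (smul_eq_zero.1 h1).resolve_left two_ne_zero

/-- The map `(x, y) ↦ f(y, x)* - f(x, y)` is again sesquilinear and vanishes on the diagonal. -/
theorem sesquilinear_star_apply [StarAddMonoid G] [StarModule ℂ G] {f : E →ₗ⋆[ℂ] E →ₗ[ℂ] G}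
    (h : ∀ x, star (f x x) = f x x) (x y : E) : star (f y x) = f x y := by
  let g : E →ₗ⋆[ℂ] E →ₗ[ℂ] G := LinearMap.mk₂'ₛₗ (starRingEnd ℂ) (RingHom.id ℂ)
    (fun x y => star (f y x)) (fun x y z => by simp) (fun c x y => by simp)
    (fun x y z => by simp) (fun c x y => by simp)
  have := sesquilinear_eq_zero_of_diag (f := g - f) (fun x => by simp [g, h]) x y
  simpa [g, sub_eq_zero] using this

end Polarization

/-! ### Complex powers and the modular group. -/

section Powers

variable {n : ℕ}

theorem cpow_zero (ρ : Mat n) : cpow ρ 0 = 1 := by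
  rw [cpow, zero_smul, NormedSpace.exp_zero]

theorem cpow_add (ρ : Mat n) (z w : ℂ) : cpow ρ (z + w) = cpow ρ z * cpow ρ w := by
  rw [cpow, add_smul, Matrix.exp_add_of_commute]
  · rfl
  · exact ((Commute.refl _).smul_left z).smul_right w

theorem cpow_mul_cpow_neg (ρ : Mat n) (z : ℂ) : cpow ρ z * cpow ρ (-z) = 1 := by
  rw [← cpow_add, add_neg_cancel, cpow_zero]

theorem cpow_neg_mul_cpow (ρ : Mat n) (z : ℂ) : cpow ρ (-z) * cpow ρ z = 1 := by
  rw [← cpow_add, neg_add_cancel, cpow_zero]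

open scoped Matrix.Norms.L2Operator in
theorem cpow_one {ρ : Mat n} (hρ : ρ.PosDef) : cpow ρ 1 = ρ := by
  rw [cpow, one_smul]
  exact CFC.exp_log ρ (Matrix.isStrictlyPositive_iff_posDef.2 hρ)

open scoped Matrix.Norms.L2Operator in
theorem star_cpow (ρ : Mat n) (z : ℂ) : star (cpow ρ z) = cpow ρ (star z) := by
  rw [cpow, cpow, NormedSpace.star_exp, star_smul]
  congr 2
  exact cfc_predicate Real.log ρ

open scoped Matrix.Norms.L2Operator in
theorem differentiable_cpow_apply (ρ : Mat n) (i j : Fin n) :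
    Differentiable ℂ fun z => cpow ρ z i j := by
  have h : Differentiable ℂ fun z => cpow ρ z := fun z =>
    (hasDerivAt_exp_smul_const (𝕂 := ℂ) (cfc Real.log ρ) z).differentiableAt
  let l : Mat n →L[ℂ] ℂ := LinearMap.toContinuousLinearMap (Matrix.entryLinearMap ℂ ℂ i j)
  exact l.differentiable.comp h

/-- The modular group `σ_z(A) = σ^{iz} A σ^{-iz}`. -/
def modular (σ : Mat n) (z : ℂ) (A : Mat n) : Mat n :=
  cpow σ (Complex.I * z) * A * cpow σ (-(Complex.I * z))

theorem differentiable_modular_apply (σ A : Mat n) (i j : Fin n) :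
    Differentiable ℂ fun z => modular σ z A i j := by
  simp only [modular, Matrix.mul_apply]
  have h : ∀ i j, Differentiable ℂ fun z => cpow σ (Complex.I * z) i j := fun i j =>
    (differentiable_cpow_apply σ i j).comp (by fun_prop : Differentiable ℂ fun z => Complex.I * z)
  have h' : ∀ i j, Differentiable ℂ fun z => cpow σ (-(Complex.I * z)) i j := fun i j =>
    (differentiable_cpow_apply σ i j).comp
      (by fun_prop : Differentiable ℂ fun z => -(Complex.I * z))
  fun_prop

theorem modular_one (σ : Mat n) (z : ℂ) : modular σ z 1 = 1 := by
  rw [modular, mul_one, cpow_mul_cpow_neg]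

end Powers

/-! ### Positivity and faithfulness of the trace pairing. -/

section Trace

variable {n : ℕ}

theorem tau_mul_comm (A B : Mat n) : tau (A * B) = tau (B * A) := by
  rw [tau, tau, Matrix.trace_mul_comm]

theorem star_tau (A : Mat n) : star (tau A) = tau (star A) := by
  rw [tau, tau, Matrix.star_eq_conjTranspose, Matrix.trace_conjTranspose, star_mul, mul_comm]
  simp

theorem inv_natCast_nonneg (n : ℕ) : (0 : ℂ) ≤ (n : ℂ)⁻¹ := by
  simp

theorem tau_nonneg {A : Mat n} (hA : 0 ≤ A) : 0 ≤ tau A := by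
  exact mul_nonneg (inv_natCast_nonneg n) (Matrix.nonneg_iff_posSemidef.1 hA).trace_nonneg

theorem exists_star_mul_self {A : Mat n} (hA : 0 ≤ A) : ∃ B : Mat n, A = star B * B :=
  CStarAlgebra.nonneg_iff_eq_star_mul_self.1 hA

theorem tau_mul_nonneg {A ρ : Mat n} (hA : 0 ≤ A) (hρ : 0 ≤ ρ) : 0 ≤ tau (A * ρ) := by
  obtain ⟨B, rfl⟩ := exists_star_mul_self hρ
  rw [← mul_assoc, tau_mul_comm, ← mul_assoc]
  refine tau_nonneg ?_
  simpa using star_left_conjugate_nonneg hA (star B)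

theorem tau_mul_mono {A A' ρ : Mat n} (hA : A ≤ A') (hρ : 0 ≤ ρ) :
    tau (A * ρ) ≤ tau (A' * ρ) := by
  have := tau_mul_nonneg (sub_nonneg.2 hA) hρ
  rw [sub_mul, tau, Matrix.trace_sub, mul_sub] at this
  exact sub_nonneg.1 this

theorem eq_zero_of_tau_mul_eq_zero {A ρ : Mat n} (hA : 0 ≤ A) (hρ : ρ.PosDef)
    (h : tau (A * ρ) = 0) : A = 0 := by
  obtain ⟨B, rfl⟩ := exists_star_mul_self hA
  obtain ⟨R, rfl⟩ := exists_star_mul_self (Matrix.nonneg_iff_posSemidef.2 hρ.posSemidef)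
  have hn : (n : ℂ)⁻¹ ≠ 0 ∨ n = 0 := by
    by_cases hn : n = 0
    · exact Or.inr hn
    · exact Or.inl (inv_ne_zero (Nat.cast_ne_zero.2 hn))
  rcases hn with hn | rfl
  · rw [← mul_assoc, tau_mul_comm, ← mul_assoc, ← mul_assoc] at h
    have h1 : (star (B * star R) * (B * star R)).trace = 0 := by
      rw [star_mul, star_star, ← mul_assoc]
      exact (mul_eq_zero.1 h).resolve_left hn
    have h2 : B * star R = 0 := Matrix.trace_conjTranspose_mul_self_eq_zero_iff.1 h1
    have hR : IsUnit (star R * R) := hρ.isUnit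
    have h3 : B * (star R * R) = 0 := by rw [← mul_assoc, h2, zero_mul]
    have h4 : B = 0 := hR.mul_left_injective (by simpa using h3)
    rw [h4, mul_zero]
  · ext i
    exact i.elim0

theorem tau_smul (c : ℂ) (A : Mat n) : tau (c • A) = c * tau A := by
  rw [tau, tau, Matrix.trace_smul, smul_eq_mul]; ring

theorem tau_add (A B : Mat n) : tau (A + B) = tau A + tau B := by
  rw [tau, tau, tau, Matrix.trace_add, mul_add]

end Trace

/-! ### Positivity of the adjoint semigroup. -/

section Semigroup

variable {n : ℕ}

theorem IsCompletelyPositive.map_nonneg {Φ : Mat n →ₗ[ℂ] Mat n} (hΦ : IsCompletelyPositive Φ)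
    {A : Mat n} (hA : 0 ≤ A) : 0 ≤ Φ A := by
  obtain ⟨B, rfl⟩ := exists_star_mul_self hA
  simpa using hΦ 1 (fun _ => B) (fun _ => 1)

theorem tau_mul_vecMulVec (A : Mat n) (x : Fin n → ℂ) :
    tau (Matrix.vecMulVec x (star x) * A) = (n : ℂ)⁻¹ * (star x ⬝ᵥ A.mulVec x) := by
  rw [tau, Matrix.trace_mul_comm, Matrix.mul_vecMulVec, Matrix.trace_vecMulVec, dotProduct_comm]

/-- Strictness comes from the faithful invariant state: for `X = xx*`, if `τ(Φ(X)ρ) = 0` then `Φ(X)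
= 0`, so `τ(Xσ) = τ(Φ(X)σ) = 0`, which forces `x = 0`. -/
theorem posDef_dagger {Φ : Mat n →ₗ[ℂ] Mat n} (hΦ : IsCompletelyPositive Φ) {σ : Mat n}
    (hσ : σ.PosDef) (hinv : ∀ A, tau (Φ A * σ) = tau (A * σ)) {ρ : Mat n} (hρ : ρ.PosDef) :
    (dagger Φ ρ).PosDef := by
  rcases Nat.eq_zero_or_pos n with rfl | hn
  · refine Matrix.PosDef.of_dotProduct_mulVec_pos (by ext i; exact i.elim0) fun x hx => ?_
    exact (hx (Subsingleton.elim _ _)).elim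
  have hn' : (0 : ℂ) < (n : ℂ)⁻¹ :=
    lt_of_le_of_ne (inv_natCast_nonneg n) (inv_ne_zero (Nat.cast_ne_zero.2 hn.ne')).symm
  have hpos : ∀ x : Fin n → ℂ, x ≠ 0 → 0 < star x ⬝ᵥ (dagger Φ ρ).mulVec x := by
    intro x hx
    have hX : (0 : Mat n) ≤ Matrix.vecMulVec x (star x) :=
      Matrix.nonneg_iff_posSemidef.2 (Matrix.posSemidef_vecMulVec_self_star x)
    have h1 : 0 < tau (Φ (Matrix.vecMulVec x (star x)) * ρ) := by
      refine lt_of_le_of_ne (tau_mul_nonneg (hΦ.map_nonneg hX)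
        (Matrix.nonneg_iff_posSemidef.2 hρ.posSemidef)) fun h0 => ?_
      have h2 := eq_zero_of_tau_mul_eq_zero (hΦ.map_nonneg hX) hρ h0.symm
      have h3 := hinv (Matrix.vecMulVec x (star x))
      rw [h2, zero_mul, tau_mul_vecMulVec] at h3
      have h4 := mul_pos hn' (hσ.dotProduct_mulVec_pos hx)
      rw [← h3] at h4
      simp [tau] at h4
    rw [tau_map_mul, tau_mul_vecMulVec] at h1
    exact (mul_pos_iff_of_pos_left hn').1 h1
  refine Matrix.PosDef.of_dotProduct_mulVec_pos ?_ hpos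
  have hreal : ∀ x : Fin n → ℂ, 0 ≤ star x ⬝ᵥ (dagger Φ ρ).mulVec x := fun x => by
    rcases eq_or_ne x 0 with rfl | hx
    · simp
    · exact (hpos x hx).le
  let f : (Fin n → ℂ) →ₗ⋆[ℂ] (Fin n → ℂ) →ₗ[ℂ] ℂ :=
    LinearMap.mk₂'ₛₗ (starRingEnd ℂ) (RingHom.id ℂ)
      (fun x y => star x ⬝ᵥ (dagger Φ ρ).mulVec y) (fun x y z => by simp [add_dotProduct])
      (fun c x y => by simp) (fun x y z => by simp [Matrix.mulVec_add, dotProduct_add])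
      (fun c x y => by simp [Matrix.mulVec_smul])
  ext i j
  have := sesquilinear_star_apply (f := f) (fun x => (hreal x).isSelfAdjoint)
    (Pi.single i 1) (Pi.single j 1)
  simpa [f] using this

end Semigroup

/-! ### Holomorphy and trace forms on the bimodule. -/

section Bimodule

variable {n : ℕ} {F : Type*} [NormedAddCommGroup F] [NormedSpace ℂ F]
  [FiniteDimensional ℂ F] [Module (Mat n) F] [Module (Mat n)ᵐᵒᵖ F]
  [IsScalarTower ℂ (Mat n) F] [IsScalarTower ℂ (Mat n)ᵐᵒᵖ F]
  [SMulCommClass (Mat n) (Mat n)ᵐᵒᵖ F]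

theorem actBoth_apply (A B : Mat n) (ξ : F) : actBoth A B ξ = A • op B • ξ := rfl

/-- Expresses the action by scalar coefficients and fixed linear maps, so that holomorphy of
`A(z)ξ(z)` reduces to that of the entries of `A`. -/
theorem sum_smul_single (A : Mat n) (ξ : F) :
    A • ξ = ∑ i, ∑ j, A i j • actBoth (Matrix.single i j 1) 1 ξ := by
  conv_lhs => rw [Matrix.matrix_eq_sum_single A]
  simp only [Finset.sum_smul, actBoth_apply, MulOpposite.op_one, one_smul, ← smul_assoc,
    Matrix.smul_single, smul_eq_mul, mul_one]

theorem sum_op_smul_single (A : Mat n) (ξ : F) :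
    op A • ξ = ∑ i, ∑ j, A i j • actBoth 1 (Matrix.single i j 1) ξ := by
  conv_lhs => rw [Matrix.matrix_eq_sum_single A]
  simp only [Finset.op_sum, Finset.sum_smul, actBoth_apply, one_smul, ← smul_assoc,
    ← MulOpposite.op_smul, Matrix.smul_single, smul_eq_mul, mul_one]

theorem differentiable_linearMap {E : Type*} [NormedAddCommGroup E] [NormedSpace ℂ E]
    (T : F →ₗ[ℂ] E) : Differentiable ℂ T :=
  (LinearMap.toContinuousLinearMap T).differentiable

theorem differentiable_smul {A : ℂ → Mat n} {ξ : ℂ → F}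
    (hA : ∀ i j, Differentiable ℂ fun z => A z i j) (hξ : Differentiable ℂ ξ) :
    Differentiable ℂ fun z => A z • ξ z := by
  simp only [sum_smul_single]
  refine Differentiable.fun_sum fun i _ => Differentiable.fun_sum fun j _ => ?_
  exact (hA i j).smul ((differentiable_linearMap _).comp hξ)

theorem differentiable_op_smul {A : ℂ → Mat n} {ξ : ℂ → F}
    (hA : ∀ i j, Differentiable ℂ fun z => A z i j) (hξ : Differentiable ℂ ξ) :
    Differentiable ℂ fun z => op (A z) • ξ z := by
  simp only [sum_op_smul_single]
  refine Differentiable.fun_sum fun i _ => Differentiable.fun_sum fun j _ => ?_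
  exact (hA i j).smul ((differentiable_linearMap _).comp hξ)

theorem differentiable_map_matrix {A : ℂ → Mat n} (T : Mat n →ₗ[ℂ] F)
    (hA : ∀ i j, Differentiable ℂ fun z => A z i j) : Differentiable ℂ fun z => T (A z) := by
  have h : ∀ M : Mat n, T M = ∑ i, ∑ j, M i j • T (Matrix.single i j 1) := fun M => by
    conv_lhs => rw [Matrix.matrix_eq_sum_single M]
    simp only [map_sum, ← map_smul, Matrix.smul_single, smul_eq_mul, mul_one]
  rw [funext fun z => h (A z)]
  exact Differentiable.fun_sum fun i _ => Differentiable.fun_sum fun j _ =>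
    (hA i j).smul (differentiable_const _)

theorem entire_eq_of_eq_on_real {E : Type*} [NormedAddCommGroup E] [NormedSpace ℂ E]
    [CompleteSpace E] {f g : ℂ → E} (hf : Differentiable ℂ f) (hg : Differentiable ℂ g)
    (h : ∀ t : ℝ, f t = g t) : f = g := by
  refine AnalyticOnNhd.eq_of_frequently_eq (z₀ := 0) (fun z _ => hf.analyticAt z)
    (fun z _ => hg.analyticAt z) ?_
  have h1 : Filter.Tendsto (fun t : ℝ => (t : ℂ)) (𝓝[≠] 0) (𝓝[≠] 0) := by
    refine tendsto_nhdsWithin_of_tendsto_nhds_of_eventually_within _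
      ((Complex.continuous_ofReal.tendsto' 0 0 (by simp)).mono_left nhdsWithin_le_nhds) ?_
    filter_upwards [self_mem_nhdsWithin] with t ht
    simpa using ht
  exact h1.frequently (Filter.Frequently.of_forall h)

variable [HilbertBimodule n F]

theorem ip_op_smul (ξ η : F) (B : Mat n) : ip n ξ (op B • η) = ip n ξ η * B := by
  simpa [ip] using HilbertBimodule.ip_smul ξ η 1 B

theorem ip_smul_right (ξ η : F) (A : Mat n) : ip n ξ (A • η) = ip n (star A • ξ) η := by
  simpa [ip] using HilbertBimodule.ip_smul ξ η A 1

theorem ip_nonneg (ξ : F) : 0 ≤ ip n ξ ξ := HilbertBimodule.ip_nonneg ξ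

theorem star_ip (ξ η : F) : star (ip n η ξ) = ip n ξ η :=
  sesquilinear_star_apply (f := HilbertBimodule.ip (n := n) (F := F))
    (fun ξ => (ip_nonneg ξ).isSelfAdjoint) ξ η

theorem ip_op_smul_left (ξ η : F) (B : Mat n) : ip n (op B • ξ) η = star B * ip n ξ η := by
  rw [← star_ip, ip_op_smul, star_mul, star_ip]

/-- The sesquilinear form `τ((ξ|η)ρ)`. -/
def form (ρ : Mat n) : F →ₗ⋆[ℂ] F →ₗ[ℂ] ℂ :=
  LinearMap.mk₂'ₛₗ (starRingEnd ℂ) (RingHom.id ℂ) (fun ξ η => tau (ip n ξ η * ρ))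
    (fun ξ ξ' η => by simp [ip, add_mul, tau_add])
    (fun c ξ η => by simp [ip, tau_smul])
    (fun ξ η η' => by simp [ip, add_mul, tau_add])
    (fun c ξ η => by simp [ip, tau_smul])

theorem form_apply (ρ : Mat n) (ξ η : F) : form ρ ξ η = tau (ip n ξ η * ρ) := rfl

theorem isPosDefForm_form {ρ : Mat n} (hρ : ρ.PosDef) : IsPosDefForm (form (F := F) ρ) where
  conj_symm ξ η := by
    rw [form_apply, form_apply, star_tau, star_mul, star_ip, tau_mul_comm]
    congr 2
    exact hρ.isHermitian
  nonneg ξ := tau_mul_nonneg (ip_nonneg ξ) (Matrix.nonneg_iff_posSemidef.2 hρ.posSemidef)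
  definite ξ h := (HilbertBimodule.ip_self_eq_zero ξ).1
    (eq_zero_of_tau_mul_eq_zero (ip_nonneg ξ) hρ h)

theorem form_smul_right (ρ : Mat n) (ξ η : F) (A : Mat n) :
    form ρ ξ (A • η) = form ρ (star A • ξ) η := by
  rw [form_apply, form_apply, ip_smul_right]

theorem form_op_smul_right (ρ : Mat n) (ξ η : F) (A : Mat n) :
    form ρ ξ (op A • η) = form (A * ρ) ξ η := by
  rw [form_apply, form_apply, ip_op_smul, mul_assoc]

open scoped Matrix.Norms.L2Operator in
-- For `B = vv*` the matrix `B*XB` is `⟨v, Xv⟩ vv*`, so its norm determines the nonnegative number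
-- `⟨v, Xv⟩`.
theorem eq_of_norm_conj_eq {X Y : Mat n} (hX : 0 ≤ X) (hY : 0 ≤ Y)
    (h : ∀ B : Mat n, ‖star B * X * B‖ = ‖star B * Y * B‖) : X = Y := by
  have hquad : ∀ v : Fin n → ℂ, star v ⬝ᵥ X.mulVec v = star v ⬝ᵥ Y.mulVec v := by
    intro v
    rcases eq_or_ne v 0 with rfl | hv
    · simp
    have hB : ∀ M : Mat n, star (Matrix.vecMulVec v (star v)) * M * Matrix.vecMulVec v (star v) =
        (star v ⬝ᵥ M.mulVec v) • Matrix.vecMulVec v (star v) := fun M => by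
      rw [Matrix.star_eq_conjTranspose, Matrix.conjTranspose_vecMulVec, star_star, mul_assoc,
        Matrix.mul_vecMulVec, Matrix.vecMulVec_mul_vecMulVec]
      ext i j; simp [Matrix.vecMulVec_apply, mul_left_comm]
    have h1 := h (Matrix.vecMulVec v (star v))
    have hne : ‖Matrix.vecMulVec v (star v)‖ ≠ 0 := by
      rw [norm_ne_zero_iff]
      intro h0
      apply hv
      funext i
      have := congrFun (congrFun h0 i) i
      simpa [Matrix.vecMulVec_apply] using this
    rw [hB, hB, norm_smul, norm_smul] at h1
    have h2 := mul_right_cancel₀ hne h1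
    have hx := (Matrix.nonneg_iff_posSemidef.1 hX).dotProduct_mulVec_nonneg v
    have hy := (Matrix.nonneg_iff_posSemidef.1 hY).dotProduct_mulVec_nonneg v
    rw [← Complex.norm_of_nonneg' hx, ← Complex.norm_of_nonneg' hy, h2]
  exact le_antisymm
    ((le_iff_dotProduct hX.isSelfAdjoint hY.isSelfAdjoint).2 fun v => (hquad v).le)
    ((le_iff_dotProduct hY.isSelfAdjoint hX.isSelfAdjoint).2 fun v => (hquad v).ge)

end Bimodule

/-! ### Analytic extension of the group and the involution `S`. -/

namespace Calculus

variable {n : ℕ} {F : Type*} [NormedAddCommGroup F] [NormedSpace ℂ F]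
  [FiniteDimensional ℂ F] [Module (Mat n) F] [Module (Mat n)ᵐᵒᵖ F]
  [IsScalarTower ℂ (Mat n) F] [IsScalarTower ℂ (Mat n)ᵐᵒᵖ F]
  [SMulCommClass (Mat n) (Mat n)ᵐᵒᵖ F] [HilbertBimodule n F]
  {σ : Mat n} {L : Mat n →ₗ[ℂ] Mat n} (C : Calculus σ L F)

theorem V_smul_modular (t : ℝ) (A B : Mat n) (ξ : F) :
    C.V t (A • op B • ξ) = modular σ t A • op (modular σ t B) • C.V t ξ :=
  C.V_smul t A B ξ

open scoped Matrix.Norms.L2Operator in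
theorem norm_modular (σ : Mat n) (t : ℝ) (A : Mat n) : ‖modular σ t A‖ = ‖A‖ := by
  have hstar : star (cpow σ (Complex.I * t)) = cpow σ (-(Complex.I * t)) := by
    rw [star_cpow]
    congr 1
    simp
  have hU : cpow σ (Complex.I * t) ∈ unitary (Mat n) := by
    rw [Unitary.mem_iff, hstar]
    exact ⟨cpow_neg_mul_cpow σ _, cpow_mul_cpow_neg σ _⟩
  rw [modular, ← hstar, CStarRing.norm_mul_mem_unitary _ (Unitary.star_mem hU),
    CStarRing.norm_mem_unitary_mul _ hU]

theorem star_modular_ofReal (σ : Mat n) (t : ℝ) (A : Mat n) :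
    star (modular σ t A) = modular σ t (star A) := by
  rw [modular, modular, star_mul, star_mul, star_cpow, star_cpow, mul_assoc]
  congr 3 <;> simp

theorem modular_mul (σ : Mat n) (z : ℂ) (A B : Mat n) :
    modular σ z (A * B) = modular σ z A * modular σ z B := by
  simp only [modular, mul_assoc]
  rw [← mul_assoc (cpow σ (-(Complex.I * z))) (cpow σ (Complex.I * z)), cpow_neg_mul_cpow, one_mul]

theorem modular_modular_neg (σ : Mat n) (z : ℂ) (A : Mat n) :
    modular σ z (modular σ (-z) A) = A := by
  simp only [modular, mul_assoc, mul_neg, neg_neg, cpow_mul_cpow_neg, mul_one]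
  rw [← mul_assoc, cpow_mul_cpow_neg, one_mul]

theorem tau_modular_mul (hσ : σ.PosDef) (z : ℂ) (A : Mat n) :
    tau (modular σ z A * σ) = tau (A * σ) := by
  have hcomm : cpow σ (-(Complex.I * z)) * σ = σ * cpow σ (-(Complex.I * z)) := by
    have h := cpow_add σ (-(Complex.I * z)) 1
    rwa [add_comm, cpow_add, cpow_one hσ, eq_comm] at h
  rw [modular, mul_assoc, hcomm, ← mul_assoc, tau_mul_comm, ← mul_assoc, ← mul_assoc,
    cpow_neg_mul_cpow, one_mul]

open scoped Matrix.Norms.L2Operator in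
-- Isometry alone compares norms, but it holds at every `ξB`, where it compares the norms of
-- `B*(ξ|ξ)B` and `B*σ_{-t}((V_tξ|V_tξ))B`; these norms determine a positive matrix.
theorem ip_V_self (t : ℝ) (ξ : F) : ip n (C.V t ξ) (C.V t ξ) = modular σ t (ip n ξ ξ) := by
  have hnn : ∀ s : ℝ, ∀ A : Mat n, 0 ≤ A → 0 ≤ modular σ s A := fun s A hA => by
    obtain ⟨B, rfl⟩ := exists_star_mul_self hA
    rw [modular_mul, ← star_modular_ofReal]
    exact star_mul_self_nonneg _
  have key : ip n ξ ξ = modular σ ((-t : ℝ) : ℂ) (ip n (C.V t ξ) (C.V t ξ)) := by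
    refine eq_of_norm_conj_eq (ip_nonneg ξ) (hnn _ _ (ip_nonneg _)) fun B => ?_
    have h1 := C.V_isometry t (op B • ξ)
    have h2 := C.V_smul_modular t 1 B ξ
    rw [one_smul, modular_one, one_smul] at h2
    rw [h2, HilbertBimodule.norm_eq (n := n) (op _ • C.V t ξ),
      HilbertBimodule.norm_eq (n := n) (op B • ξ), Real.sqrt_inj (norm_nonneg _) (norm_nonneg _)] at h1
    change ‖ip n _ _‖ = ‖ip n _ _‖ at h1
    rw [ip_op_smul, ip_op_smul_left, ip_op_smul, ip_op_smul_left, star_modular_ofReal] at h1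
    rw [← h1, ← norm_modular σ t (star B * _ * B), modular_mul, modular_mul, Complex.ofReal_neg,
      modular_modular_neg]
  rw [key, Complex.ofReal_neg, modular_modular_neg]

theorem form_V (hσ : σ.PosDef) (t : ℝ) (ξ η : F) :
    form σ (C.V t ξ) (C.V t η) = form σ ξ η := by
  let f : F →ₗ⋆[ℂ] F →ₗ[ℂ] ℂ := LinearMap.mk₂'ₛₗ (starRingEnd ℂ) (RingHom.id ℂ)
    (fun ξ η => form σ (C.V t ξ) (C.V t η) - form σ ξ η)
    (fun ξ ξ' η => by simp; ring) (fun c ξ η => by simp; ring)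
    (fun ξ η η' => by simp; ring) (fun c ξ η => by simp; ring)
  have := sesquilinear_eq_zero_of_diag (f := f) (fun ξ => by
    simp only [f, LinearMap.mk₂'ₛₗ_apply, form_apply, ip_V_self, tau_modular_mul hσ, sub_self]) ξ η
  exact sub_eq_zero.1 this

/-- The orbit of `∂(A)B` is `∂(σ_t(A))σ_t(B)`, which is visibly entire in `t`, and such vectors span
`F`. -/
theorem exists_isAnalyticExtension : ∃ W, IsAnalyticExtension C.V W := by
  let S : Submodule ℂ F :=
    { carrier := {ξ | ∃ g : ℂ → F, Differentiable ℂ g ∧ ∀ t : ℝ, g t = C.V t ξ}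
      add_mem' := by
        rintro ξ η ⟨g, hg, hg'⟩ ⟨k, hk, hk'⟩
        exact ⟨g + k, hg.add hk, fun t => by simp [hg', hk']⟩
      zero_mem' := ⟨0, differentiable_const _, fun t => by simp⟩
      smul_mem' := by
        rintro c ξ ⟨g, hg, hg'⟩
        exact ⟨c • g, hg.const_smul c, fun t => by simp [hg']⟩ }
  have hS : S = ⊤ := by
    rw [eq_top_iff, ← C.span_eq_top, Submodule.span_le]
    rintro _ ⟨A, B, rfl⟩
    refine ⟨fun z => op (modular σ z B) • C.d (modular σ z A),
      differentiable_op_smul (differentiable_modular_apply σ B)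
        (differentiable_map_matrix C.d (differentiable_modular_apply σ A)), fun t => ?_⟩
    have h := C.V_smul_modular t 1 B (C.d A)
    rw [one_smul, modular_one, one_smul] at h
    rw [h, ← C.d_modular]
    rfl
  have hS' : ∀ ξ, ∃ g : ℂ → F, Differentiable ℂ g ∧ ∀ t : ℝ, g t = C.V t ξ := fun ξ => by
    have : ξ ∈ S := hS ▸ Submodule.mem_top
    exact this
  choose g hg hg' using hS'
  let b := Module.finBasis ℂ F
  refine ⟨fun z => b.constr ℂ fun i => g (b i) z, fun ξ => ?_, fun t => b.ext fun i => ?_⟩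
  · simp only [Module.Basis.constr_apply_fintype]
    exact Differentiable.fun_sum fun i _ => (hg (b i)).const_smul _
  · rw [Module.Basis.constr_basis, hg']

theorem isAnalyticExtension : IsAnalyticExtension C.V (analyticExtension C.V) := by
  rw [analyticExtension, dif_pos C.exists_isAnalyticExtension]
  exact C.exists_isAnalyticExtension.choose_spec

/-- The analytic extension of `C.V`. -/
abbrev W : ℂ → F →ₗ[ℂ] F := analyticExtension C.V

theorem differentiable_W (ξ : F) : Differentiable ℂ fun z => C.W z ξ := C.isAnalyticExtension.1 ξ

theorem W_ofReal (t : ℝ) : C.W t = C.V t := C.isAnalyticExtension.2 t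

theorem W_smul (z : ℂ) (A B : Mat n) (ξ : F) :
    C.W z (A • op B • ξ) = modular σ z A • op (modular σ z B) • C.W z ξ := by
  refine congrFun (entire_eq_of_eq_on_real (C.differentiable_W _)
    (differentiable_smul (differentiable_modular_apply σ A)
      (differentiable_op_smul (differentiable_modular_apply σ B) (C.differentiable_W ξ)))
    fun t => ?_) z
  simp only [W_ofReal, V_smul_modular]

theorem W_comm {Q : F →ₗ[ℂ] F} (hQ : ∀ (t : ℝ) ξ, Q (C.V t ξ) = C.V t (Q ξ)) (z : ℂ) (ξ : F) :
    Q (C.W z ξ) = C.W z (Q ξ) := by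
  refine congrFun (entire_eq_of_eq_on_real ((differentiable_linearMap Q).comp
    (C.differentiable_W ξ)) (C.differentiable_W (Q ξ)) fun t => ?_) z
  simp only [Function.comp_apply, W_ofReal, hQ]

/-- The identity theorem is applied in each variable in turn, first in `z` with a real second time.
-/
theorem W_add (z w : ℂ) (ξ : F) : C.W (z + w) ξ = C.W z (C.W w ξ) := by
  have h1 : ∀ (s : ℝ) (z : ℂ), C.W (z + s) ξ = C.W z (C.V s ξ) := fun s z => by
    refine congrFun (entire_eq_of_eq_on_real (f := fun z => C.W (z + s) ξ)
      (g := fun z => C.W z (C.V s ξ))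
      ((C.differentiable_W ξ).comp (differentiable_id.add_const _))
      (C.differentiable_W (C.V s ξ)) fun t => ?_) z
    rw [← Complex.ofReal_add, W_ofReal, W_ofReal, C.V_add]
    rfl
  refine congrFun (entire_eq_of_eq_on_real (f := fun w => C.W (z + w) ξ)
    (g := fun w => C.W z (C.W w ξ))
    ((C.differentiable_W ξ).comp (differentiable_id.const_add _))
    ((differentiable_linearMap (C.W z)).comp (C.differentiable_W ξ)) fun t => ?_) w
  simp only [h1, W_ofReal]

theorem W_zero (ξ : F) : C.W 0 ξ = ξ := by
  rw [← Complex.ofReal_zero, W_ofReal, C.V_zero, LinearMap.id_apply]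

/-- On the real line this is unitarity of `V_t`. The right side is entire in `z` because the two
conjugations, of the parameter and of the form, cancel. -/
theorem form_W (hσ : σ.PosDef) (z : ℂ) (ξ η : F) :
    form σ η (C.W z ξ) = form σ (C.W (-star z) η) ξ := by
  have hk : Differentiable ℂ fun w => form σ ξ (C.W (-w) η) :=
    (differentiable_linearMap (form σ ξ)).comp
      ((C.differentiable_W η).comp differentiable_id.neg)
  have h := congrFun (entire_eq_of_eq_on_real (f := fun z => form σ η (C.W z ξ))
    (g := fun z => star (form σ ξ (C.W (-star z) η)))
    ((differentiable_linearMap (form σ η)).comp (C.differentiable_W ξ))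
    (fun z => differentiableAt_conj_conj_iff.2 (hk (star z))) fun t => ?_) z
  · exact h.trans ((isPosDefForm_form hσ).conj_symm _ _)
  · rw [(isPosDefForm_form hσ).conj_symm, W_ofReal, Complex.star_def, Complex.conj_ofReal,
      ← Complex.ofReal_neg, W_ofReal, ← C.form_V hσ t (C.V (-t) η) ξ,
      ← LinearMap.comp_apply (C.V t) (C.V (-t)), ← C.V_add, add_neg_cancel, C.V_zero, LinearMap.id_apply]

theorem form_W_half (hσ : σ.PosDef) (ξ η : F) :
    form σ (C.W (-(Complex.I / 2)) η) (C.W (-(Complex.I / 2)) ξ) =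
      form σ η (C.W (-Complex.I) ξ) := by
  have h := C.form_W hσ (-(Complex.I / 2)) (C.W (-(Complex.I / 2)) ξ) η
  rw [← W_add] at h
  convert h.symm using 3
  · congr 2
    simp [neg_div]
  · congr 2
    ring

/-- The involution `S ξ = J (V_{-i/2} ξ)` with `S (A ξ B) = B* (S ξ) A*`. -/
def S (ξ : F) : F := C.J (C.W (-(Complex.I / 2)) ξ)

/-- The twist by `σ^{1/2}` in the rule for `J` is undone by the modular twist of `V_{-i/2}`. -/
theorem S_smul (A B : Mat n) (ξ : F) : C.S (A • op B • ξ) = star B • op (star A) • C.S ξ := by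
  have hI : Complex.I * -(Complex.I / 2) = 1 / 2 := by
    linear_combination (-1 / 2 : ℂ) * Complex.I_mul_I
  have hs : ∀ M : Mat n, cpow σ (1 / 2) * star (modular σ (-(Complex.I / 2)) M) *
      cpow σ (-(1 / 2)) = star M := fun M => by
    rw [modular, hI, star_mul, star_mul, star_cpow, star_cpow]
    have h2 : star (1 / 2 : ℂ) = 1 / 2 := by simp
    rw [star_neg, h2, ← mul_assoc, cpow_mul_cpow_neg, one_mul, mul_assoc, cpow_mul_cpow_neg,
      mul_one]
  rw [S, W_smul, C.J_smul, hs, hs, S]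

/-- `J` preserves the definite form of `σ` on the diagonal, and `V_{-i/2}` has inverse `V_{i/2}`. -/
theorem S_eq_zero (hσ : σ.PosDef) {ξ : F} (h : C.S ξ = 0) : ξ = 0 := by
  have h1 := C.J_ip (C.W (-(Complex.I / 2)) ξ) (C.W (-(Complex.I / 2)) ξ)
  change form σ (C.S ξ) (C.S ξ) = form σ _ _ at h1
  rw [h, map_zero] at h1
  have h2 := (isPosDefForm_form hσ).definite _ h1.symm
  have h3 := C.W_add (Complex.I / 2) (-(Complex.I / 2)) ξ
  rwa [add_neg_cancel, W_zero, h2, map_zero] at h3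

/-- Since `S` exchanges left and right actions, the density `ρσ⁻¹` can be moved off the form as a
right factor of `Sη` and becomes a left factor of `η`. For the remaining weight `σ`, the rule for
`J` gives `V_{-i}`. Writing `σ = (σρ⁻¹)ρ` restores the weight `ρ`, and the collected factors are
those of `V^ρ_{-i}`. -/
theorem form_S (hσ : σ.PosDef) {ρ : Mat n} (hρ : ρ.PosDef) (ξ η : F) :
    form ρ (C.S ξ) (C.S η) = form ρ η (C.Vρ ρ (-Complex.I) ξ) := by
  have hI : Complex.I * -Complex.I = 1 := by simp
  have hσ1 : cpow σ (-1) * σ = 1 := by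
    have := cpow_neg_mul_cpow σ 1
    rwa [cpow_one hσ] at this
  have hρ1 : cpow ρ (-1) * ρ = 1 := by
    have := cpow_neg_mul_cpow ρ 1
    rwa [cpow_one hρ] at this
  have hV : C.Vρ ρ (-Complex.I) ξ =
      (ρ * cpow σ (-1)) • op (σ * cpow ρ (-1)) • C.W (-Complex.I) ξ := by
    rw [Vρ, LinearMap.comp_apply, actBoth_apply, hI, cpow_one hρ, cpow_one hσ]
  have hS := C.S_smul (star (ρ * cpow σ (-1))) 1 η
  rw [star_star, star_one, one_smul, MulOpposite.op_one, one_smul] at hS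
  calc form ρ (C.S ξ) (C.S η) = form (ρ * cpow σ (-1) * σ) (C.S ξ) (C.S η) := by
        rw [mul_assoc, hσ1, mul_one]
    _ = form σ (C.S ξ) (C.S (star (ρ * cpow σ (-1)) • η)) := by
        rw [hS, form_op_smul_right]
    _ = form σ (star (ρ * cpow σ (-1)) • η) (C.W (-Complex.I) ξ) := by
        rw [← C.form_W_half hσ]
        exact C.J_ip _ _
    _ = form (σ * cpow ρ (-1) * ρ) η ((ρ * cpow σ (-1)) • C.W (-Complex.I) ξ) := by
        rw [form_smul_right, mul_assoc, hρ1, mul_one]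
    _ = _ := by
        rw [hV, smul_comm, form_op_smul_right]

theorem isPosDefForm_Vρ (hσ : σ.PosDef) {ρ : Mat n} (hρ : ρ.PosDef) :
    IsPosDefForm ((form ρ).compl₂ (C.Vρ ρ (-Complex.I))) where
  conj_symm ξ η := by
    rw [LinearMap.compl₂_apply, LinearMap.compl₂_apply, ← C.form_S hσ hρ, ← C.form_S hσ hρ,
      (isPosDefForm_form hρ).conj_symm]
  nonneg ξ := by
    rw [LinearMap.compl₂_apply, ← C.form_S hσ hρ]
    exact (isPosDefForm_form hρ).nonneg _
  definite ξ h := by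
    rw [LinearMap.compl₂_apply, ← C.form_S hσ hρ] at h
    exact C.S_eq_zero hσ ((isPosDefForm_form hρ).definite _ h)

end Calculus

/-! ### From the curvature bound to the gradient estimate. -/

theorem form_map_le {n : ℕ} {F : Type*} [NormedAddCommGroup F] [NormedSpace ℂ F]
    [FiniteDimensional ℂ F] [Module (Mat n) F] [Module (Mat n)ᵐᵒᵖ F]
    [IsScalarTower ℂ (Mat n) F] [IsScalarTower ℂ (Mat n)ᵐᵒᵖ F]
    [SMulCommClass (Mat n) (Mat n)ᵐᵒᵖ F] [HilbertBimodule n F]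
    {Φ : Mat n →ₗ[ℂ] Mat n} {Q : F →ₗ[ℂ] F} {c : ℝ} {ξ : F}
    (h : ip n (Q ξ) (Q ξ) ≤ c • Φ (ip n ξ ξ)) {ρ : Mat n} (hρ : ρ.PosDef) :
    form ρ (Q ξ) (Q ξ) ≤ c * form (dagger Φ ρ) ξ ξ := by
  have h1 := tau_mul_mono h (Matrix.nonneg_iff_posSemidef.2 hρ.posSemidef)
  rwa [← Complex.coe_smul, smul_mul_assoc, tau_smul, tau_map_mul] at h1

end

end QMS

theorem mainTheorem2 {n : ℕ} (σ : Mat n) (hσ : σ.PosDef) (hσ1 : QMS.tau σ = 1)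
    (P : ℝ≥0 → Mat n →ₗ[ℂ] Mat n) (hP : QMS.IsQuantumMarkovSemigroup P)
    (hPσ : QMS.IsGNSSymmetric σ P)
    (L : Mat n →ₗ[ℂ] Mat n) (hL : QMS.IsGenerator P L)
    {F : Type*} [NormedAddCommGroup F] [NormedSpace ℂ F] [FiniteDimensional ℂ F]
    [Module (Mat n) F] [Module (Mat n)ᵐᵒᵖ F]
    [IsScalarTower ℂ (Mat n) F] [IsScalarTower ℂ (Mat n)ᵐᵒᵖ F]
    [SMulCommClass (Mat n) (Mat n)ᵐᵒᵖ F] [QMS.HilbertBimodule n F]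
    (C : QMS.Calculus σ L F) (K : ℝ) (hK : C.HasIntertwiningCurvature P K)
    (Λ : ℝ≥0 → ℝ≥0 → ℝ≥0) (hΛ : QMS.IsOperatorMean Λ) :
    C.GradientEstimate P Λ K := by
  obtain ⟨Q, -, hQd, hQJ, hQV, hQ⟩ := hK
  obtain ⟨hΛc, h, hpos, hmono, -, hΛh⟩ := hΛ
  intro A _ ρ hρ t
  have hρ' : (QMS.dagger (P t) ρ).PosDef :=
    -- GNS-symmetry against `1` and unitality give invariance of `τ(·σ)`.
    QMS.posDef_dagger (hP.completelyPositive t) hσ (fun A => by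
      simpa [hP.unital t] using hPσ t A 1) hρ
  have hf : ∀ x : ℝ, 0 < x → ((Λ 1 x.toNNReal : ℝ≥0) : ℝ) = h x := fun x hx => by
    rw [hΛh 1 _ one_pos (Real.toNNReal_pos.2 hx)]
    simp [Real.coe_toNNReal x hx.le]
  -- Continuity of `h` is read off from that of `Λ`, since `h(x) = Λ(1, x)` for `x > 0`.
  have hcont : ContinuousOn h (Set.Ioi 0) := by
    have h1 : Continuous fun x : ℝ => ((Λ 1 x.toNNReal : ℝ≥0) : ℝ) :=
      NNReal.continuous_coe.comp (hΛc.comp (by fun_prop : Continuous fun x : ℝ =>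
        ((1 : ℝ≥0), x.toNNReal)))
    exact h1.continuousOn.congr fun x hx => (hf x hx).symm
  have hQS : ∀ ξ, C.S (Q t ξ) = Q t (C.S ξ) := fun ξ => by
    rw [QMS.Calculus.S, QMS.Calculus.S, ← C.W_comm (fun s ξ => hQV t s ξ), hQJ]
  have hle := (QMS.isPosDefForm_form hρ).mean_le hmono hpos hcont hf
    (QMS.isPosDefForm_form hρ') (C.isPosDefForm_Vρ hσ hρ) (C.isPosDefForm_Vρ hσ hρ') (Q t)
    (Real.exp_pos (-2 * K * t)) (fun ξ => QMS.form_map_le (hQ t ξ) hρ)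
    -- The bound on the second form is the curvature bound at `Sξ`, because `Q t` commutes with `S`.
    (fun ξ => by
      rw [← C.form_S hσ hρ, ← C.form_S hσ hρ', hQS]
      exact QMS.form_map_le (hQ t (C.S ξ)) hρ) (C.d A)
  have hnn := fun {ρ : Mat n} (hρ : ρ.PosDef) (ξ : F) =>
    (QMS.isPosDefForm_form hρ).mean_nonneg (f := fun x => ((Λ 1 x.toNNReal : ℝ≥0) : ℝ))
      (fun x => NNReal.coe_nonneg _) (C.isPosDefForm_Vρ hσ hρ) ξ
  rw [hQd] at hle
  have hsq : ∀ {ρ : Mat n}, ρ.PosDef → ∀ ξ, C.normΛ Λ ρ ξ ^ 2 = (C.innerΛ Λ ρ ξ ξ).re :=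
    fun hρ ξ => Real.sq_sqrt (Complex.le_def.1 (hnn hρ ξ)).1
  rw [hsq hρ, hsq hρ']
  have := (Complex.le_def.1 hle).1
  rwa [Complex.re_ofReal_mul] at this
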